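/- **Theorem.** Let $T\ge 1$ be an integer, let $\gamma>0$, and for $\mathsf{SNR}>0$ let $\rho=\rho(\mathsf{SNR})\ge 0$ be given by $\rho^2=\mathsf{SNR}^{\gamma}$ (for $\gamma=1$, $\rho^2$ is the $\mathsf{SNR}$ itself). Here $\mathcal{CN}(0,v)$ is the circularly symmetric complex Gaussian law with $\mathbb E|z|^2=v$, $\log$ is the logarithm to base $2$, and mutual informations are in bits. For each $\mathsf{SNR}>0$ let $\boldsymbol g,\boldsymbol w',\boldsymbol X,\boldsymbol W,\boldsymbol Q$ be mutually independent, where $\boldsymbol g\sim\mathcal{CN}(0,\rho^2)$, $\boldsymbol w'\sim\mathcal{CN}(0,1)$, and $\boldsymbol X$ and $\boldsymbol W$ are vectors of length $T-1$ with i.i.d. $\mathcal{CN}(0,1)$ elements. Put $$\boldsymbol Y=\boldsymbol g\boldsymbol X+\boldsymbol W,\qquad \hat{\boldsymbol g}=e^{i\angle(\boldsymbol g+\boldsymbol w')}+(\boldsymbol g+\boldsymbol w'),\qquad \boldsymbol Y'=\frac{\boldsymbol Y}{\hat{\boldsymbol g}}=\frac{\boldsymbol g}{\hat{\boldsymbol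 g}}\boldsymbol X+\frac{\boldsymbol W}{\hat{\boldsymbol g}},\qquad \hat{\boldsymbol Y}=\boldsymbol Y'+\boldsymbol Q,$$ where $\angle z$ is the angle (argument) of $z$ and the vector $\boldsymbol Q$ has the same distribution as the vector $\boldsymbol W/\hat{\boldsymbol g}$. For real functions $f_1,f_2$ of $\mathsf{SNR}$ write $f_1\doteq f_2$ (respectively $f_1\overset{.}{\ge}f_2$) if the limits $\lim_{\mathsf{SNR}\to\infty}f_j(\mathsf{SNR})/\log(\mathsf{SNR})$, $j=1,2$, exist and are equal (respectively the first is at least the second). Then $I(\hat{\boldsymbol Y};\boldsymbol X)$ and $I(\hat{\boldsymbol Y};\boldsymbol Y'\mid\boldsymbol X)$ are finite for every $\mathsf{SNR}>0$, and $$I(\hat{\boldsymbol Y};\boldsymbol X)\overset{.}{\ge}(T-1)\log(\rho^2),\qquad I(\hat{\boldsymbol Y};\boldsymbol Y'\mid\boldsymbol X)\doteq 0,$$ and hence $$I(\hat{\boldsymbol Y};\boldsymbol X)-I(\hat{\boldsymbol Y};\boldsymbol Y'\mid\boldsymbol X)\overset{.}{\ge}(T-1)\log(\rho^2).$$ -/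

import Mathlib

open MeasureTheory ProbabilityTheory Filter Topology
open scoped NNReal ENNReal

noncomputable section

namespace TrainScale

/-- The circularly symmetric complex Gaussian law `CN(0, v)`: the real and the imaginary part are
independent, each `N(0, v / 2)`, so that `E |z| ^ 2 = v`. -/
def complexGaussian (v : ℝ≥0) : Measure ℂ :=
  ((gaussianReal 0 (v / 2)).prod (gaussianReal 0 (v / 2))).map Complex.measurableEquivRealProd.symm

instance instIsProbabilityMeasureComplexGaussian (v : ℝ≥0) :
    IsProbabilityMeasure (complexGaussian v) :=
  Measure.isProbabilityMeasure_map Complex.measurableEquivRealProd.symm.measurable.aemeasurable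

/-- The law of a vector of length `n` with i.i.d. `CN(0, 1)` entries. -/
def stdComplexGaussianVec (n : ℕ) : Measure (Fin n → ℂ) :=
  Measure.pi fun _ => complexGaussian 1

section Information

variable {Ω α β δ : Type*} [MeasurableSpace Ω] [MeasurableSpace α] [MeasurableSpace β]
  [MeasurableSpace δ]

/-- Mutual information `I(U; V)` in bits: the Kullback-Leibler divergence of the joint law from the
product of the marginal laws (`klDiv` is in nats). -/
def mutualInfo (P : Measure Ω) (U : Ω → α) (V : Ω → β) : ℝ≥0∞ :=
  InformationTheory.klDiv (P.map fun ω => (U ω, V ω)) ((P.map U).prod (P.map V)) /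
    ENNReal.ofReal (Real.log 2)

/-- Conditional mutual information `I(U; V | Z)` in bits: the Kullback-Leibler divergence of the
joint law of `(Z, (U, V))` from the law under which `Z` has its own law and `U`, `V` are
conditionally independent given `Z` with their own conditional laws. -/
def condMutualInfo [StandardBorelSpace α] [Nonempty α] [StandardBorelSpace β] [Nonempty β]
    (P : Measure Ω) [IsFiniteMeasure P] (U : Ω → α) (V : Ω → β) (Z : Ω → δ) : ℝ≥0∞ :=
  InformationTheory.klDiv (P.map fun ω => (Z ω, (U ω, V ω)))
      ((P.map Z).compProd ((condDistrib U Z P).prod (condDistrib V Z P))) /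
    ENNReal.ofReal (Real.log 2)

end Information

/-- Order equality: `f₁ s / log s` and `f₂ s / log s` converge, to the same limit, as `s → ∞`. -/
def OrderEq (f₁ f₂ : ℝ → ℝ) : Prop :=
  ∃ a : ℝ, Tendsto (fun s => f₁ s / Real.logb 2 s) atTop (𝓝 a) ∧
    Tendsto (fun s => f₂ s / Real.logb 2 s) atTop (𝓝 a)

/-- Order inequality: `f₁ s / log s` and `f₂ s / log s` converge as `s → ∞`, and the limit of the
first is at least the limit of the second. -/
def OrderGE (f₁ f₂ : ℝ → ℝ) : Prop :=
  ∃ a b : ℝ, Tendsto (fun s => f₁ s / Real.logb 2 s) atTop (𝓝 a) ∧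
    Tendsto (fun s => f₂ s / Real.logb 2 s) atTop (𝓝 b) ∧ b ≤ a

section Channel

variable {Ω : Type*} {n : ℕ}

/-- The scaling `ĝ = exp (i ∠(g + w')) + (g + w')`. -/
def gHat (g w' : Ω → ℂ) (ω : Ω) : ℂ :=
  Complex.exp (Complex.I * (Complex.arg (g ω + w' ω) : ℂ)) + (g ω + w' ω)

/-- The received vector `Y = g X + W`. -/
def received (g : Ω → ℂ) (X W : Ω → Fin n → ℂ) (ω : Ω) : Fin n → ℂ :=
  fun i => g ω * X ω i + W ω i

/-- The scaled vector `Y' = Y / ĝ = (g / ĝ) X + W / ĝ`. -/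
def scaled (g w' : Ω → ℂ) (X W : Ω → Fin n → ℂ) (ω : Ω) : Fin n → ℂ :=
  fun i => received g X W ω i / gHat g w' ω

/-- The quantized vector `Ŷ = Y' + Q`. -/
def quantized (g w' : Ω → ℂ) (X W Q : Ω → Fin n → ℂ) (ω : Ω) : Fin n → ℂ :=
  fun i => scaled g w' X W ω i + Q ω i

/-- The joint law of fading `g`, training noise `w'`, input `X`, noise `W` and quantization noise
`Q`. The last four fields together say that the five are mutually independent. -/
structure IsModel [MeasurableSpace Ω] (P : Measure Ω) (ρ : ℝ≥0) (g w' : Ω → ℂ)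
    (X W Q : Ω → Fin n → ℂ) : Prop where
  law_g : HasLaw g (complexGaussian (ρ ^ 2)) P
  law_w' : HasLaw w' (complexGaussian 1) P
  law_X : HasLaw X (stdComplexGaussianVec n) P
  law_W : HasLaw W (stdComplexGaussianVec n) P
  law_Q : IdentDistrib Q (fun ω i => W ω i / gHat g w' ω) P P
  indep_w' : IndepFun g w' P
  indep_X : IndepFun (fun ω => (g ω, w' ω)) X P
  indep_W : IndepFun (fun ω => (g ω, w' ω, X ω)) W P
  indep_Q : IndepFun (fun ω => (g ω, w' ω, X ω, W ω)) Q P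

end Channel

end TrainScale

end

/-! Write n = T - 1 and r = ρ, use natural logarithms, and put k = `logFactor r / r`, so that k is
1/r up to a factor of order log r. The scaling ĝ has the phase of g + w', hence |ĝ| = 1 + |g + w'|
never vanishes, and |g - ĝ| ≤ 1 + |w'|. Therefore Ŷ - X = (g/ĝ - 1) X + W/ĝ + Q is small in mean
square: E|Ŷ - X|² ≤ 18 n k² (`lintegral_normSqSum_quantOut_sub_le`). The input to this is a bound E
(1 + |g + w|)⁻² ≤ k² that is uniform in the shift w (`lintegral_inv_sq_complexGaussian_le`).

Every information bound compares the true law with a Gaussian guess. Guessing X from Ŷ by the law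
CN(Ŷ, k²) and applying Gibbs' inequality gives I(Ŷ; X) ≥ -2n log k - 18n, which is n log r² up to a
doubly logarithmic term. Guessing Ŷ from X by CN(X, k²) bounds I(Ŷ; Y' | X): given Y' and the scale
ĝ' hidden in Q, the vector Ŷ is Gaussian with mean Y' and variance |ĝ'|⁻², so the divergence is at
most 2n (log k + E log |ĝ'|) + 18n. Here E log |ĝ'| is at most log r + O(1) for r ≥ 1, which cancels
the 1/r in k and leaves O(log log r).

An upper bound on I(Ŷ; X) is needed too (`klDiv_quantOut_input_le`): it supplies finiteness, without
which Gibbs' inequality says nothing about the real value, and existence of the limit. It comes from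
replacing Y by Gaussian noise of variance 1 + r² that is independent of X.

Auxiliary variables such as ĝ' are adjoined to make both laws conditionally Gaussian
(`affineGaussian`), and data processing removes them. -/

noncomputable section

namespace TrainScale

open InformationTheory

/-! ### Variational bounds on relative entropy and mutual information -/

section Divergence

variable {α β γ δ Ω : Type*} [MeasurableSpace α] [MeasurableSpace β] [MeasurableSpace γ]
  [MeasurableSpace δ] [MeasurableSpace Ω]

/-- The log-likelihood ratio of a measure given by an exponential density. -/
lemma llr_withDensity_exp (ν : Measure α) [IsProbabilityMeasure ν] {f : α → ℝ}
    (hf : Measurable f) :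
    llr (ν.withDensity fun x => ENNReal.ofReal (Real.exp (f x))) ν
      =ᵐ[ν.withDensity fun x => ENNReal.ofReal (Real.exp (f x))] f := by
  refine (withDensity_absolutelyContinuous ν _).ae_le ?_
  filter_upwards [Measure.rnDeriv_withDensity ν
    (show Measurable fun x => ENNReal.ofReal (Real.exp (f x)) by fun_prop)] with x hx
  rw [llr, hx, ENNReal.toReal_ofReal (Real.exp_pos _).le, Real.log_exp]

/-- Divergence of a probability measure given by an exponential density. -/
lemma klDiv_eq_ofReal_integral_of_withDensity_exp {μ ν : Measure α} [IsProbabilityMeasure μ]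
    [IsProbabilityMeasure ν] {f : α → ℝ} (hf : Measurable f)
    (h : μ = ν.withDensity fun x => ENNReal.ofReal (Real.exp (f x))) (hint : Integrable f μ) :
    klDiv μ ν = ENNReal.ofReal (∫ x, f x ∂μ) := by
  have hac : μ ≪ ν := h ▸ withDensity_absolutelyContinuous ν _
  have hl : llr μ ν =ᵐ[μ] f := by
    have := llr_withDensity_exp ν hf
    rwa [← h] at this
  rw [klDiv_of_ac_of_integrable hac (hint.congr hl.symm), integral_congr_ae hl]
  simp

/-- Gibbs' variational lower bound for the divergence. -/
lemma integral_le_toReal_klDiv {μ ν η : Measure α} [IsProbabilityMeasure μ]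
    [IsProbabilityMeasure ν] [IsProbabilityMeasure η] {f : α → ℝ} (hf : Measurable f)
    (h : η = ν.withDensity fun x => ENNReal.ofReal (Real.exp (f x))) (hint : Integrable f μ)
    (hfin : klDiv μ ν ≠ ∞) : ∫ x, f x ∂μ ≤ (klDiv μ ν).toReal := by
  obtain ⟨hac, hllr⟩ := klDiv_ne_top_iff.mp hfin
  have hone : ∫⁻ x, ENNReal.ofReal (Real.exp (f x)) ∂ν = 1 := by
    rw [← setLIntegral_univ, ← withDensity_apply _ .univ, ← h, measure_univ]
  have hexp : Integrable (fun x => Real.exp (f x)) ν := by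
    refine ⟨by fun_prop, ?_⟩
    rw [hasFiniteIntegral_iff_ofReal (ae_of_all _ fun x => (Real.exp_pos _).le), hone]
    exact ENNReal.one_lt_top
  have hexp1 : ∫ x, Real.exp (f x) ∂ν = 1 := by
    rw [integral_eq_lintegral_of_nonneg_ae (ae_of_all _ fun x => (Real.exp_pos _).le)
      (by fun_prop), hone, ENNReal.toReal_one]
  -- Tilting `ν` by `f` changes the mean log-likelihood ratio by -∫ f plus log ∫ exp f; the latter
  -- vanishes because `η` is a probability measure.
  have key := integral_llr_tilted_right hac hint hexp hllr
  have : IsProbabilityMeasure (ν.tilted f) := isProbabilityMeasure_tilted hexp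
  have h0 : 0 ≤ ∫ x, llr μ (ν.tilted f) x ∂μ := by
    rw [← toReal_klDiv_of_measure_eq (hac.trans (absolutelyContinuous_tilted hexp)) (by simp)]
    exact ENNReal.toReal_nonneg
  rw [hexp1, Real.log_one] at key
  rw [toReal_klDiv_of_measure_eq hac (by simp)]
  linarith

/-- The product of the marginals minimizes the divergence from a joint law among product measures
with the same second factor. -/
lemma klDiv_prod_map_le [StandardBorelSpace β] [Nonempty β] (P : Measure Ω)
    [IsProbabilityMeasure P] {U : Ω → α} {V : Ω → β} (hU : Measurable U) (hV : Measurable V)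
    (R : Measure α) [IsProbabilityMeasure R] :
    klDiv (P.map fun ω => (U ω, V ω)) ((P.map U).prod (P.map V)) ≤
      klDiv (P.map fun ω => (U ω, V ω)) (R.prod (P.map V)) := by
  have : IsProbabilityMeasure (P.map U) := Measure.isProbabilityMeasure_map hU.aemeasurable
  have : IsProbabilityMeasure (P.map V) := Measure.isProbabilityMeasure_map hV.aemeasurable
  -- By the chain rule the right side exceeds the left by the divergence of the law of `U` from `R`.
  rw [← compProd_map_condDistrib (X := U) (Y := V) hV.aemeasurable, ← Measure.compProd_const,
    ← Measure.compProd_const, klDiv_compProd_eq_add (ν := R)]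
  exact le_add_self

/-- Conditional version of `klDiv_prod_map_le`, with the reference conditional law of `U` given `Z`
generated by the function `r` of `Z` and of an independent noise with law `m`. -/
lemma klDiv_compProd_condDistrib_le [StandardBorelSpace α] [Nonempty α] [StandardBorelSpace β]
    [Nonempty β] (P : Measure Ω) [IsProbabilityMeasure P] {U : Ω → α} {V : Ω → β} {Z : Ω → δ}
    (hU : Measurable U) (hV : Measurable V) (hZ : Measurable Z) (m : Measure γ)
    [IsProbabilityMeasure m] {r : δ × γ → α} (hr : Measurable r) :
    klDiv (P.map fun ω => (Z ω, (U ω, V ω)))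
        ((P.map Z).compProd ((condDistrib U Z P).prod (condDistrib V Z P))) ≤
      klDiv (P.map fun ω => ((Z ω, V ω), U ω))
        (((P.map fun ω => (Z ω, V ω)).prod m).map fun p => (p.1, r (p.1.1, p.2))) := by
  have : IsProbabilityMeasure (P.map Z) := Measure.isProbabilityMeasure_map hZ.aemeasurable
  have hZU : Measurable fun ω => (Z ω, U ω) := by fun_prop
  have : IsProbabilityMeasure (P.map fun ω => (Z ω, U ω)) :=
    Measure.isProbabilityMeasure_map hZU.aemeasurable
  set R : Kernel δ α := (Kernel.id ×ₖ Kernel.const δ m).map r with hR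
  have : IsMarkovKernel R := Kernel.IsMarkovKernel.map _ hr
  -- `η` ignores its `α` coordinate: this encodes conditional independence given `Z`, and puts both
  -- reference laws in a form to which the chain rule applies.
  set η : Kernel (δ × α) β := (condDistrib V Z P).comap Prod.fst measurable_fst with hη
  have hassoc : ∀ (κ : Kernel δ α) [IsMarkovKernel κ],
      (((P.map Z) ⊗ₘ κ) ⊗ₘ η).map MeasurableEquiv.prodAssoc =
        (P.map Z) ⊗ₘ (κ ×ₖ condDistrib V Z P) := by
    intro κ _
    refine Measure.ext_of_lintegral _ fun f hf => ?_
    rw [lintegral_map hf (MeasurableEquiv.measurable _), Measure.lintegral_compProd (by fun_prop),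
      Measure.lintegral_compProd (by fun_prop), Measure.lintegral_compProd hf]
    refine lintegral_congr fun z => ?_
    rw [Kernel.lintegral_prod _ _ _ (by fun_prop)]
    rfl
  have hjoint : ((P.map fun ω => (Z ω, U ω)) ⊗ₘ condDistrib V (fun ω => (Z ω, U ω)) P).map
      MeasurableEquiv.prodAssoc = P.map fun ω => (Z ω, (U ω, V ω)) := by
    rw [compProd_map_condDistrib hV.aemeasurable,
      Measure.map_map (MeasurableEquiv.measurable _) (by fun_prop)]
    rfl
  have hmarg : (P.map Z) ⊗ₘ condDistrib U Z P = P.map fun ω => (Z ω, U ω) :=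
    compProd_map_condDistrib hU.aemeasurable
  have href : (((P.map fun ω => (Z ω, V ω)).prod m).map fun p => (p.1, r (p.1.1, p.2))).map
      (fun p => (p.1.1, (p.2, p.1.2))) = (P.map Z) ⊗ₘ (R ×ₖ condDistrib V Z P) := by
    rw [← compProd_map_condDistrib (X := Z) (Y := V) hV.aemeasurable]
    refine Measure.ext_of_lintegral _ fun f hf => ?_
    rw [lintegral_map hf (by fun_prop), lintegral_map (by fun_prop) (by fun_prop),
      lintegral_prod _ (by fun_prop), Measure.lintegral_compProd (by fun_prop),
      Measure.lintegral_compProd hf]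
    refine lintegral_congr fun z => ?_
    rw [Kernel.lintegral_prod_symm _ _ _ (by fun_prop)]
    refine lintegral_congr fun v => ?_
    rw [hR, Kernel.lintegral_map _ hr _ (by fun_prop), Kernel.lintegral_id_prod (by fun_prop)]
    simp
  calc klDiv (P.map fun ω => (Z ω, (U ω, V ω)))
        ((P.map Z) ⊗ₘ ((condDistrib U Z P) ×ₖ (condDistrib V Z P)))
      ≤ klDiv ((P.map fun ω => (Z ω, U ω)) ⊗ₘ condDistrib V (fun ω => (Z ω, U ω)) P)
          ((P.map fun ω => (Z ω, U ω)) ⊗ₘ η) := by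
        rw [← hjoint, ← hassoc, hmarg]
        exact klDiv_map_le _ _ (MeasurableEquiv.measurable _)
    _ ≤ klDiv ((P.map fun ω => (Z ω, U ω)) ⊗ₘ condDistrib V (fun ω => (Z ω, U ω)) P)
          (((P.map Z) ⊗ₘ R) ⊗ₘ η) := by
        -- Chain rule: the discarded term is the divergence of the law of `(Z, U)` from the one
        -- generated by `R`.
        rw [klDiv_compProd_eq_add (ν := (P.map Z) ⊗ₘ R)]
        exact le_add_self
    _ = klDiv ((P.map fun ω => (Z ω, (U ω, V ω))).map MeasurableEquiv.prodAssoc.symm)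
          (((P.map Z) ⊗ₘ (R ×ₖ condDistrib V Z P)).map MeasurableEquiv.prodAssoc.symm) := by
        rw [← hjoint, ← hassoc R]
        simp only [MeasurableEquiv.map_symm_map]
    _ ≤ klDiv (P.map fun ω => (Z ω, (U ω, V ω))) ((P.map Z) ⊗ₘ (R ×ₖ condDistrib V Z P)) :=
        klDiv_map_le _ _ (MeasurableEquiv.measurable _)
    _ = klDiv ((P.map fun ω => ((Z ω, V ω), U ω)).map fun p => (p.1.1, (p.2, p.1.2)))
          ((((P.map fun ω => (Z ω, V ω)).prod m).map fun p => (p.1, r (p.1.1, p.2))).map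
            (fun p => (p.1.1, (p.2, p.1.2)))) := by
        rw [href, Measure.map_map (by fun_prop) (by fun_prop)]
        rfl
    _ ≤ _ := klDiv_map_le _ _ (by fun_prop)

end Divergence

/-! ### Complex Gaussian vectors and divergences between conditionally Gaussian laws -/

section GaussianVector

variable {n : ℕ} {α : Type*} [MeasurableSpace α]

/-- The squared Euclidean norm of a complex vector. -/
def normSqSum (x : Fin n → ℂ) : ℝ := ∑ i, ‖x i‖ ^ 2

lemma normSqSum_nonneg (x : Fin n → ℂ) : 0 ≤ normSqSum x :=
  Finset.sum_nonneg fun _ _ => by positivity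

@[fun_prop]
lemma measurable_normSqSum : Measurable (normSqSum (n := n)) := by
  unfold normSqSum
  fun_prop

lemma normSqSum_smul (c : ℂ) (x : Fin n → ℂ) : normSqSum (c • x) = ‖c‖ ^ 2 * normSqSum x := by
  simp [normSqSum, mul_pow, Finset.mul_sum]

lemma normSqSum_add_le (x y : Fin n → ℂ) :
    normSqSum (x + y) ≤ 2 * normSqSum x + 2 * normSqSum y := by
  simp only [normSqSum, Finset.mul_sum, ← Finset.sum_add_distrib, Pi.add_apply]
  refine Finset.sum_le_sum fun i _ => ?_
  nlinarith [norm_add_le (x i) (y i), norm_nonneg (x i + y i), sq_nonneg (‖x i‖ - ‖y i‖),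
    norm_nonneg (x i), norm_nonneg (y i)]

lemma normSqSum_add_add_le (x y z : Fin n → ℂ) :
    normSqSum (x + y + z) ≤ 3 * normSqSum x + 3 * normSqSum y + 3 * normSqSum z := by
  simp only [normSqSum, Finset.mul_sum, ← Finset.sum_add_distrib, Pi.add_apply]
  refine Finset.sum_le_sum fun i _ => ?_
  have h : ‖x i + y i + z i‖ ≤ ‖x i‖ + ‖y i‖ + ‖z i‖ := norm_add₃_le
  nlinarith [norm_nonneg (x i + y i + z i), sq_nonneg (‖x i‖ - ‖y i‖),
    sq_nonneg (‖x i‖ - ‖z i‖), sq_nonneg (‖y i‖ - ‖z i‖)]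

/-- The density of `CN(0, 1)`. -/
def stdComplexPDF (z : ℂ) : ℝ := Real.pi⁻¹ * Real.exp (-‖z‖ ^ 2)

lemma stdComplexPDF_pos (z : ℂ) : 0 < stdComplexPDF z := by
  unfold stdComplexPDF
  positivity

@[fun_prop]
lemma measurable_stdComplexPDF : Measurable stdComplexPDF := by
  unfold stdComplexPDF
  fun_prop

lemma gaussianPDFReal_mul_half_eq (x y : ℝ) :
    gaussianPDFReal 0 (1 / 2) x * gaussianPDFReal 0 (1 / 2) y = stdComplexPDF ⟨x, y⟩ := by
  have h1 : (2 * Real.pi * ((1 / 2 : ℝ≥0) : ℝ)) = Real.pi := by push_cast; ring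
  have h2 : (2 * ((1 / 2 : ℝ≥0) : ℝ)) = 1 := by push_cast; ring
  rw [gaussianPDFReal, gaussianPDFReal, stdComplexPDF, h1, h2, mul_mul_mul_comm, ← Real.exp_add,
    ← mul_inv, Real.mul_self_sqrt Real.pi_pos.le, ← Complex.normSq_eq_norm_sq, Complex.normSq_mk]
  congr 2
  ring

lemma complexGaussian_one_eq_withDensity :
    complexGaussian 1 = volume.withDensity fun z => ENNReal.ofReal (stdComplexPDF z) := by
  have hv : (1 / 2 : ℝ≥0) ≠ 0 := by norm_num
  rw [complexGaussian, gaussianReal_of_var_ne_zero _ hv, prod_withDensity (by fun_prop)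
    (by fun_prop)]
  refine Measure.ext_of_lintegral _ fun f hf => ?_
  have hmp := Complex.volume_preserving_equiv_real_prod.symm
  rw [lintegral_map hf (MeasurableEquiv.measurable _),
    lintegral_withDensity_eq_lintegral_mul _ (by fun_prop) (by fun_prop),
    lintegral_withDensity_eq_lintegral_mul _ (by fun_prop) hf,
    ← hmp.lintegral_comp (by fun_prop)]
  refine lintegral_congr fun p => ?_
  simp only [Pi.mul_apply, gaussianPDF, ← ENNReal.ofReal_mul (gaussianPDFReal_nonneg _ _ _),
    gaussianPDFReal_mul_half_eq]
  rfl

lemma integrable_stdComplexPDF : Integrable stdComplexPDF := by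
  refine ⟨by fun_prop, ?_⟩
  rw [hasFiniteIntegral_iff_ofReal (ae_of_all _ fun z => (stdComplexPDF_pos z).le),
    ← setLIntegral_univ, ← withDensity_apply _ .univ, ← complexGaussian_one_eq_withDensity,
    measure_univ]
  exact ENNReal.one_lt_top

/-- The density of a vector with i.i.d. `CN(0, 1)` entries. -/
def stdComplexVecPDF (x : Fin n → ℂ) : ℝ := (Real.pi ^ n)⁻¹ * Real.exp (-normSqSum x)

lemma stdComplexVecPDF_pos (x : Fin n → ℂ) : 0 < stdComplexVecPDF x := by
  unfold stdComplexVecPDF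
  positivity

@[fun_prop]
lemma measurable_stdComplexVecPDF : Measurable (stdComplexVecPDF (n := n)) := by
  unfold stdComplexVecPDF
  fun_prop

lemma stdComplexVecPDF_eq_prod (x : Fin n → ℂ) :
    stdComplexVecPDF x = ∏ i, stdComplexPDF (x i) := by
  simp [stdComplexVecPDF, stdComplexPDF, Finset.prod_mul_distrib, normSqSum,
    ← Real.exp_sum, Finset.sum_neg_distrib]

lemma stdComplexGaussianVec_eq_withDensity :
    stdComplexGaussianVec n =
      volume.withDensity fun x => ENNReal.ofReal (stdComplexVecPDF x) := by
  refine Measure.pi_eq fun s hs => ?_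
  have hint : ∀ i, Integrable stdComplexPDF ((volume : Measure ℂ).restrict (s i)) :=
    fun i => integrable_stdComplexPDF.integrableOn
  simp_rw [complexGaussian_one_eq_withDensity]
  rw [withDensity_apply _ (.univ_pi hs), volume_pi, Measure.restrict_pi_pi]
  simp_rw [withDensity_apply _ (hs _), stdComplexVecPDF_eq_prod]
  rw [← ofReal_integral_eq_lintegral_ofReal (Integrable.fintype_prod hint)
    (ae_of_all _ fun x => Finset.prod_nonneg fun i _ => (stdComplexPDF_pos _).le),
    integral_fintype_prod_eq_prod (f := fun _ => stdComplexPDF),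
    ENNReal.ofReal_prod_of_nonneg fun i _ =>
      integral_nonneg fun z => (stdComplexPDF_pos z).le]
  refine Finset.prod_congr rfl fun i _ => ?_
  rw [ofReal_integral_eq_lintegral_ofReal (hint i)
    (ae_of_all _ fun z => (stdComplexPDF_pos z).le)]

instance instIsProbabilityMeasureStdComplexGaussianVec :
    IsProbabilityMeasure (stdComplexGaussianVec n) := by
  unfold stdComplexGaussianVec
  infer_instance

/-- Multiplication by `c` is a rotation of each coordinate, which preserves volume, followed by a
real dilation by `‖c‖` in real dimension 2n. -/
lemma lintegral_comp_add_complex_smul (m : Fin n → ℂ) {c : ℂ} (hc : c ≠ 0)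
    {F : (Fin n → ℂ) → ℝ≥0∞} (hF : Measurable F) :
    ∫⁻ w, F (m + c • w) = ENNReal.ofReal ((‖c‖ ^ (2 * n))⁻¹) * ∫⁻ y, F y := by
  have hr : ‖c‖ ≠ 0 := norm_ne_zero_iff.mpr hc
  have hu : ‖c / ‖c‖‖ = 1 := by simp [hr]
  set u : Circle := ⟨c / ‖c‖, mem_sphere_zero_iff_norm.mpr hu⟩
  have hmp : MeasurePreserving (fun (w : Fin n → ℂ) i => rotation u (w i)) volume volume :=
    measurePreserving_pi _ _ fun _ => (rotation u).measurePreserving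
  have hdim : Module.finrank ℝ (Fin n → ℂ) = 2 * n := by
    simp [Module.finrank_pi_fintype, Complex.finrank_real_complex, mul_comm]
  have hrw : ∀ w : Fin n → ℂ, m + c • w = m + ‖c‖ • fun i => rotation u (w i) := by
    intro w
    ext i
    have : (‖c‖ : ℂ) ≠ 0 := by exact_mod_cast hr
    have hrot : rotation u (w i) = c / ‖c‖ * w i := rotation_apply _ _
    simp only [Pi.add_apply, Pi.smul_apply, hrot, Complex.real_smul, smul_eq_mul]
    field_simp
  simp_rw [hrw]
  rw [hmp.lintegral_comp (f := fun w => F (m + ‖c‖ • w)) (by fun_prop),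
    ← lintegral_map (μ := volume) (f := fun w => F (m + w)) (g := fun w => ‖c‖ • w) (by fun_prop)
      (by fun_prop), Measure.map_addHaar_smul _ hr, lintegral_smul_measure, hdim,
    lintegral_add_left_eq_self, abs_of_nonneg (by positivity), smul_eq_mul]

/-- The joint law of `A` with law `μ` and of the Gaussian vector `m A + c A • N`, where `N` has
i.i.d. `CN(0, 1)` entries and is independent of `A`. -/
def affineGaussian (μ : Measure α) (m : α → Fin n → ℂ) (c : α → ℂ) : Measure (α × (Fin n → ℂ)) :=
  (μ.prod (stdComplexGaussianVec n)).map fun p => (p.1, m p.1 + c p.1 • p.2)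

variable {μ : Measure α} {m m' : α → Fin n → ℂ} {c c' : α → ℂ}

lemma isProbabilityMeasure_affineGaussian [IsProbabilityMeasure μ] (hm : Measurable m)
    (hc : Measurable c) : IsProbabilityMeasure (affineGaussian μ m c) :=
  Measure.isProbabilityMeasure_map (by fun_prop)

lemma affineGaussian_eq_withDensity [SFinite μ] (hm : Measurable m) (hc : Measurable c)
    (hc0 : ∀ a, c a ≠ 0) :
    affineGaussian μ m c = (μ.prod volume).withDensity fun p =>
      ENNReal.ofReal ((‖c p.1‖ ^ (2 * n))⁻¹ *
        stdComplexVecPDF ((c p.1)⁻¹ • (p.2 - m p.1))) := by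
  refine Measure.ext_of_lintegral _ fun f hf => ?_
  rw [affineGaussian, lintegral_map hf (by fun_prop), lintegral_prod _ (by fun_prop),
    lintegral_withDensity_eq_lintegral_mul _ (by fun_prop) hf, lintegral_prod _ (by fun_prop)]
  refine lintegral_congr fun a => ?_
  rw [stdComplexGaussianVec_eq_withDensity,
    lintegral_withDensity_eq_lintegral_mul _ (by fun_prop) (by fun_prop)]
  have := lintegral_comp_add_complex_smul (m a) (hc0 a)
    (F := fun y => ENNReal.ofReal (stdComplexVecPDF ((c a)⁻¹ • (y - m a))) * f (a, y))
    (by fun_prop)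
  simp only [add_sub_cancel_left, inv_smul_smul₀ (hc0 a)] at this
  simp only [Pi.mul_apply]
  rw [this, ← lintegral_const_mul _ (by fun_prop)]
  refine lintegral_congr fun y => ?_
  rw [ENNReal.ofReal_mul (by positivity), mul_assoc]

/-- The log-likelihood ratio of two laws of the form `affineGaussian`. -/
def gaussianLLR (m m' : α → Fin n → ℂ) (c c' : α → ℂ) (p : α × (Fin n → ℂ)) : ℝ :=
  2 * n * Real.log ‖c' p.1‖ - 2 * n * Real.log ‖c p.1‖
    - normSqSum ((c p.1)⁻¹ • (p.2 - m p.1)) + normSqSum ((c' p.1)⁻¹ • (p.2 - m' p.1))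

lemma measurable_gaussianLLR (hm : Measurable m) (hm' : Measurable m') (hc : Measurable c)
    (hc' : Measurable c') : Measurable (gaussianLLR m m' c c') := by
  unfold gaussianLLR
  fun_prop

/-- Both laws have positive densities with respect to `μ.prod volume`, so their ratio is an
exponential. The exponential form serves both the exact divergence and Gibbs' bound. -/
lemma affineGaussian_eq_withDensity_exp [SFinite μ] (hm : Measurable m) (hm' : Measurable m')
    (hc : Measurable c) (hc' : Measurable c') (hc0 : ∀ a, c a ≠ 0) (hc0' : ∀ a, c' a ≠ 0) :
    affineGaussian μ m c = (affineGaussian μ m' c').withDensity fun p =>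
      ENNReal.ofReal (Real.exp (gaussianLLR m m' c c' p)) := by
  have hl := measurable_gaussianLLR hm hm' hc hc'
  rw [affineGaussian_eq_withDensity hm hc hc0, affineGaussian_eq_withDensity hm' hc' hc0',
    ← withDensity_mul _ (by fun_prop) (by fun_prop)]
  congr 1
  ext p
  have h1 : 0 < ‖c p.1‖ := norm_pos_iff.mpr (hc0 _)
  have h2 : 0 < ‖c' p.1‖ := norm_pos_iff.mpr (hc0' _)
  have e : ∀ x : ℝ, 0 < x → Real.exp (2 * n * Real.log x) = x ^ (2 * n) := by
    intro x hx
    rw [mul_comm, Real.exp_mul, Real.exp_log hx]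
    exact_mod_cast Real.rpow_natCast x (2 * n)
  rw [Pi.mul_apply, ← ENNReal.ofReal_mul (mul_nonneg (by positivity) (stdComplexVecPDF_pos _).le),
    gaussianLLR, Real.exp_add, Real.exp_sub, Real.exp_sub, e _ h1, e _ h2, stdComplexVecPDF,
    stdComplexVecPDF, Real.exp_neg, Real.exp_neg]
  congr 1
  field_simp

/-- The divergence between two laws of the form `affineGaussian`. -/
lemma klDiv_affineGaussian [IsProbabilityMeasure μ] (hm : Measurable m) (hm' : Measurable m')
    (hc : Measurable c) (hc' : Measurable c') (hc0 : ∀ a, c a ≠ 0) (hc0' : ∀ a, c' a ≠ 0)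
    (hint : Integrable (gaussianLLR m m' c c') (affineGaussian μ m c)) :
    klDiv (affineGaussian μ m c) (affineGaussian μ m' c') =
      ENNReal.ofReal (∫ p, gaussianLLR m m' c c' p ∂affineGaussian μ m c) := by
  have := isProbabilityMeasure_affineGaussian (μ := μ) hm hc
  have := isProbabilityMeasure_affineGaussian (μ := μ) hm' hc'
  exact klDiv_eq_ofReal_integral_of_withDensity_exp (measurable_gaussianLLR hm hm' hc hc')
    (affineGaussian_eq_withDensity_exp hm hm' hc hc' hc0 hc0') hint

end GaussianVector

/-! ### Second moments and inverse moments of Gaussian laws -/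

section Moments

lemma lintegral_sq_gaussianReal (v : ℝ≥0) :
    ∫⁻ x, ENNReal.ofReal (x ^ 2) ∂gaussianReal 0 v = v := by
  have hint : Integrable (fun x : ℝ => x ^ 2) (gaussianReal 0 v) :=
    (memLp_id_gaussianReal 2).integrable_sq
  have hvar := variance_fun_id_gaussianReal (μ := 0) (v := v)
  rw [variance_of_integral_eq_zero (by fun_prop) (by simp)] at hvar
  rw [← ofReal_integral_eq_lintegral_ofReal hint (ae_of_all _ fun x => sq_nonneg x), hvar,
    ENNReal.ofReal_coe_nnreal]

lemma lintegral_complexGaussian (v : ℝ≥0) {f : ℂ → ℝ≥0∞} (hf : Measurable f) :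
    ∫⁻ z, f z ∂complexGaussian v =
      ∫⁻ p, f ⟨p.1, p.2⟩ ∂(gaussianReal 0 (v / 2)).prod (gaussianReal 0 (v / 2)) := by
  rw [complexGaussian, lintegral_map hf (MeasurableEquiv.measurable _)]
  rfl

lemma lintegral_norm_sq_complexGaussian (v : ℝ≥0) :
    ∫⁻ z, ENNReal.ofReal (‖z‖ ^ 2) ∂complexGaussian v = v := by
  rw [lintegral_complexGaussian v (by fun_prop)]
  have h : ∀ p : ℝ × ℝ, ENNReal.ofReal (‖(⟨p.1, p.2⟩ : ℂ)‖ ^ 2) =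
      ENNReal.ofReal (p.1 ^ 2) + ENNReal.ofReal (p.2 ^ 2) := by
    intro p
    rw [← ENNReal.ofReal_add (sq_nonneg _) (sq_nonneg _), ← Complex.normSq_eq_norm_sq,
      Complex.normSq_mk, sq, sq]
  simp_rw [h]
  rw [lintegral_add_left (by fun_prop), lintegral_prod _ (by fun_prop),
    lintegral_prod _ (by fun_prop)]
  simp only [lintegral_const, measure_univ, mul_one, lintegral_sq_gaussianReal]
  rw [← ENNReal.coe_add, add_halves]

lemma lintegral_normSqSum_stdComplexGaussianVec (n : ℕ) :
    ∫⁻ x, ENNReal.ofReal (normSqSum x) ∂stdComplexGaussianVec n = n := by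
  simp_rw [normSqSum, ENNReal.ofReal_sum_of_nonneg fun _ _ => sq_nonneg _]
  rw [lintegral_finsetSum _ fun i _ => by fun_prop]
  have h : ∀ i : Fin n, ∫⁻ x, ENNReal.ofReal (‖x i‖ ^ 2) ∂stdComplexGaussianVec n = 1 := by
    intro i
    have := (measurePreserving_eval (fun _ : Fin n => complexGaussian 1) i).lintegral_comp
      (f := fun z => ENNReal.ofReal (‖z‖ ^ 2)) (by fun_prop)
    rw [stdComplexGaussianVec]
    refine this.trans ?_
    rw [lintegral_norm_sq_complexGaussian, ENNReal.coe_one]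
  rw [Finset.sum_congr rfl fun i _ => h i]
  simp

lemma lintegral_indicator_inv_one_add_abs {r : ℝ} (hr : 0 < r) :
    ∫⁻ u, ENNReal.ofReal ((Set.Iic r).indicator (fun u => (1 + u)⁻¹) |u|) =
      ENNReal.ofReal (2 * Real.log (1 + r)) := by
  have hpos : ∀ u : ℝ, 0 ≤ (Set.Iic r).indicator (fun u => (1 + u)⁻¹) |u| := fun u =>
    Set.indicator_apply_nonneg fun _ => by positivity
  have heq : (fun u : ℝ => (Set.Iic r).indicator (fun u => (1 + u)⁻¹) |u|) =
      (Set.Icc (-r) r).indicator fun u => (1 + |u|)⁻¹ := by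
    ext u
    simp only [Set.indicator, Set.mem_Iic, Set.mem_Icc, abs_le]
  have hcont : Continuous fun u : ℝ => (1 + |u|)⁻¹ :=
    Continuous.inv₀ (by fun_prop) fun u => by positivity
  have hint : Integrable fun u : ℝ => (Set.Iic r).indicator (fun u => (1 + u)⁻¹) |u| := by
    rw [heq, integrable_indicator_iff measurableSet_Icc]
    exact hcont.continuousOn.integrableOn_compact isCompact_Icc
  rw [← ofReal_integral_eq_lintegral_ofReal hint (ae_of_all _ hpos), integral_comp_abs,
    setIntegral_indicator measurableSet_Iic, Set.Ioi_inter_Iic,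
    ← intervalIntegral.integral_of_le hr.le,
    intervalIntegral.integral_comp_add_left (fun u => u⁻¹) 1, integral_inv_of_pos (by norm_num)
      (by positivity)]
  simp

/-- The peak of the density is (π r²)^(-1/2), and π ≥ 1. -/
lemma gaussianPDF_half_sq_le {r : ℝ≥0} (hr : 0 < r) (t : ℝ) :
    gaussianPDF 0 (r ^ 2 / 2) t ≤ ENNReal.ofReal ((r : ℝ)⁻¹) := by
  refine ENNReal.ofReal_le_ofReal ?_
  have hr' : (0 : ℝ) < r := hr
  rw [gaussianPDFReal]
  have h1 : (r : ℝ) ≤ √(2 * Real.pi * ((r ^ 2 / 2 : ℝ≥0) : ℝ)) := by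
    refine Real.le_sqrt_of_sq_le ?_
    push_cast
    nlinarith [Real.pi_gt_three, sq_nonneg (r : ℝ)]
  have h2 : Real.exp (-(t - 0) ^ 2 / (2 * ((r ^ 2 / 2 : ℝ≥0) : ℝ))) ≤ 1 := by
    rw [Real.exp_le_one_iff]
    exact div_nonpos_of_nonpos_of_nonneg (neg_nonpos.mpr (sq_nonneg _)) (by positivity)
  calc _ ≤ (r : ℝ)⁻¹ * 1 := by gcongr
    _ = _ := mul_one _

/-- The logarithmic factor in the moment bounds. -/
def logFactor (r : ℝ) : ℝ := 1 + 2 * Real.log (1 + r)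

lemma one_le_logFactor {r : ℝ} (hr : 0 ≤ r) : 1 ≤ logFactor r := by
  have := Real.log_nonneg (show (1 : ℝ) ≤ 1 + r by linarith)
  unfold logFactor
  linarith

/-- Split at |t + a| = r. Inside, the density is at most 1/r and the integral of 1/(1 + |u|) is 2
log(1 + r); outside, the integrand is at most 1/r. Bounding the density by its peak makes the
estimate uniform in the shift `a`. -/
lemma lintegral_inv_one_add_abs_gaussianReal_le {r : ℝ≥0} (hr : 0 < r) (a : ℝ) :
    ∫⁻ t, ENNReal.ofReal ((1 + |t + a|)⁻¹) ∂gaussianReal 0 (r ^ 2 / 2) ≤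
      ENNReal.ofReal (logFactor r / r) := by
  have hr' : (0 : ℝ) < r := hr
  have hv : r ^ 2 / 2 ≠ 0 := by positivity
  set h : ℝ → ℝ := fun u => (Set.Iic (r : ℝ)).indicator (fun u => (1 + u)⁻¹) |u| with hh
  have hmeas : Measurable h :=
    (Measurable.indicator (by fun_prop) measurableSet_Iic).comp measurable_norm
  have hpos : ∀ u : ℝ, 0 ≤ h u := fun u => Set.indicator_apply_nonneg fun _ => by positivity
  have hle : ∀ u : ℝ, (1 + |u|)⁻¹ ≤ h u + (r : ℝ)⁻¹ := by
    intro u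
    by_cases hu : |u| ≤ r
    · simp only [hh, Set.indicator_of_mem (Set.mem_Iic.mpr hu)]
      linarith [inv_pos.mpr hr']
    · have : (1 + |u|)⁻¹ ≤ (r : ℝ)⁻¹ := inv_anti₀ hr' (by linarith)
      linarith [hpos u]
  have hlint : ∫⁻ u, ENNReal.ofReal (h u) = ENNReal.ofReal (2 * Real.log (1 + r)) :=
    lintegral_indicator_inv_one_add_abs hr'
  clear_value h
  calc ∫⁻ t, ENNReal.ofReal ((1 + |t + a|)⁻¹) ∂gaussianReal 0 (r ^ 2 / 2)
      ≤ ∫⁻ t, (ENNReal.ofReal (h (t + a)) + ENNReal.ofReal ((r : ℝ)⁻¹))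
          ∂gaussianReal 0 (r ^ 2 / 2) := by
        refine lintegral_mono fun t => ?_
        rw [← ENNReal.ofReal_add (hpos _) (by positivity)]
        exact ENNReal.ofReal_le_ofReal (hle _)
    _ = ∫⁻ t, ENNReal.ofReal (h (t + a)) ∂gaussianReal 0 (r ^ 2 / 2)
          + ENNReal.ofReal ((r : ℝ)⁻¹) := by
        rw [lintegral_add_left (by fun_prop)]
        simp
    _ ≤ ENNReal.ofReal ((r : ℝ)⁻¹) * ENNReal.ofReal (2 * Real.log (1 + r))
          + ENNReal.ofReal ((r : ℝ)⁻¹) := by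
        gcongr
        rw [gaussianReal_of_var_ne_zero _ hv,
          lintegral_withDensity_eq_lintegral_mul _ (by fun_prop) (by fun_prop),
          ← hlint, ← lintegral_add_right_eq_self (fun u => ENNReal.ofReal (h u)) a, ← lintegral_const_mul _ (by fun_prop)]
        exact lintegral_mono fun t => by
          simp only [Pi.mul_apply]
          gcongr
          exact gaussianPDF_half_sq_le hr t
    _ = ENNReal.ofReal (logFactor r / r) := by
        have := Real.log_nonneg (show (1 : ℝ) ≤ 1 + r by linarith)
        rw [← ENNReal.ofReal_mul (by positivity), ← ENNReal.ofReal_add (by positivity)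
          (by positivity)]
        congr 1
        unfold logFactor
        field_simp
        ring

/-- Since (1 + |z|)² ≥ (1 + |Re z|)(1 + |Im z|), the integral is bounded by a product of two
one-dimensional ones. The square of the logarithm is harmless, as only its logarithm enters later.
-/
lemma lintegral_inv_sq_complexGaussian_le {r : ℝ≥0} (hr : 0 < r) (w : ℂ) :
    ∫⁻ g, ENNReal.ofReal (((1 + ‖g + w‖) ^ 2)⁻¹) ∂complexGaussian (r ^ 2) ≤
      ENNReal.ofReal ((logFactor r / r) ^ 2) := by
  have hL : 0 ≤ logFactor r / r := div_nonneg (zero_le_one.trans (one_le_logFactor r.2)) r.2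
  rw [lintegral_complexGaussian _ (by fun_prop)]
  calc _ ≤ ∫⁻ p : ℝ × ℝ, ENNReal.ofReal ((1 + |p.1 + w.re|)⁻¹)
          * ENNReal.ofReal ((1 + |p.2 + w.im|)⁻¹)
          ∂(gaussianReal 0 (r ^ 2 / 2)).prod (gaussianReal 0 (r ^ 2 / 2)) := by
        refine lintegral_mono fun p => ?_
        rw [← ENNReal.ofReal_mul (by positivity), ← mul_inv]
        refine ENNReal.ofReal_le_ofReal (inv_anti₀ (by positivity) ?_)
        rw [sq]
        gcongr
        · exact Complex.abs_re_le_norm (⟨p.1, p.2⟩ + w)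
        · exact Complex.abs_im_le_norm (⟨p.1, p.2⟩ + w)
    _ = (∫⁻ t, ENNReal.ofReal ((1 + |t + w.re|)⁻¹) ∂gaussianReal 0 (r ^ 2 / 2)) *
          ∫⁻ t, ENNReal.ofReal ((1 + |t + w.im|)⁻¹) ∂gaussianReal 0 (r ^ 2 / 2) :=
        lintegral_prod_mul (f := fun t => ENNReal.ofReal ((1 + |t + w.re|)⁻¹))
          (g := fun t => ENNReal.ofReal ((1 + |t + w.im|)⁻¹)) (by fun_prop) (by fun_prop)
    _ ≤ ENNReal.ofReal (logFactor r / r) * ENNReal.ofReal (logFactor r / r) := by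
        gcongr <;> exact lintegral_inv_one_add_abs_gaussianReal_le hr _
    _ = _ := by rw [← ENNReal.ofReal_mul hL, sq]

/-- The joint law of the fading and of the training noise. -/
def fadingLaw (r : ℝ≥0) : Measure (ℂ × ℂ) := (complexGaussian (r ^ 2)).prod (complexGaussian 1)

instance instIsProbabilityMeasureFadingLaw (r : ℝ≥0) : IsProbabilityMeasure (fadingLaw r) := by
  unfold fadingLaw
  infer_instance

/-- Integrate over the fading first: the bound uniform in the shift decouples the inverse square
from any function of the training noise. -/
lemma lintegral_inv_sq_fadingLaw_le {r : ℝ≥0} (hr : 0 < r) {f : ℂ → ℝ≥0∞} (hf : Measurable f) :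
    ∫⁻ h, f h.2 * ENNReal.ofReal (((1 + ‖h.1 + h.2‖) ^ 2)⁻¹) ∂fadingLaw r ≤
      (∫⁻ w, f w ∂complexGaussian 1) * ENNReal.ofReal ((logFactor r / r) ^ 2) := by
  rw [fadingLaw, lintegral_prod_symm _ (by fun_prop), ← lintegral_mul_const _ hf]
  refine lintegral_mono fun w => ?_
  simp only
  rw [lintegral_const_mul _ (by fun_prop)]
  gcongr
  exact lintegral_inv_sq_complexGaussian_le hr w

lemma lintegral_norm_add_sq_fadingLaw_le (r : ℝ≥0) :
    ∫⁻ h, ENNReal.ofReal ((1 + ‖h.1 + h.2‖) ^ 2) ∂fadingLaw r ≤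
      ENNReal.ofReal (6 + 4 * (r : ℝ) ^ 2) := by
  have hle : ∀ h : ℂ × ℂ, ENNReal.ofReal ((1 + ‖h.1 + h.2‖) ^ 2) ≤
      2 + (4 * ENNReal.ofReal (‖h.1‖ ^ 2) + 4 * ENNReal.ofReal (‖h.2‖ ^ 2)) := by
    intro h
    have e2 : (2 : ℝ≥0∞) = ENNReal.ofReal 2 := by norm_num
    have e4 : (4 : ℝ≥0∞) = ENNReal.ofReal 4 := by norm_num
    rw [e2, e4, ← ENNReal.ofReal_mul (by norm_num), ← ENNReal.ofReal_mul (by norm_num),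
      ← ENNReal.ofReal_add (by positivity) (by positivity),
      ← ENNReal.ofReal_add (by positivity) (by positivity)]
    refine ENNReal.ofReal_le_ofReal ?_
    nlinarith [norm_add_le h.1 h.2, norm_nonneg (h.1 + h.2), sq_nonneg (‖h.1‖ - ‖h.2‖),
      sq_nonneg (‖h.1 + h.2‖ - 1), norm_nonneg h.1, norm_nonneg h.2]
  refine (lintegral_mono hle).trans ?_
  rw [lintegral_add_left (by fun_prop), lintegral_add_left (by fun_prop),
    lintegral_const_mul _ (by fun_prop), lintegral_const_mul _ (by fun_prop), lintegral_const,
    measure_univ, fadingLaw, lintegral_prod _ (by fun_prop), lintegral_prod _ (by fun_prop)]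
  simp only [lintegral_const, measure_univ, mul_one, lintegral_norm_sq_complexGaussian]
  rw [ENNReal.ofReal_add (by norm_num) (by positivity), ENNReal.ofReal_mul (by norm_num),
    ENNReal.ofReal_pow (NNReal.coe_nonneg r), ENNReal.ofReal_coe_nnreal]
  refine le_of_eq ?_
  norm_num
  ring_nf

end Moments

/-! ### Reduction to an explicit product space -/

section Canonical

variable {n : ℕ}

/-- The scaling `ĝ` as a function of the fading and of the training noise. -/
def scaleFactor (h : ℂ × ℂ) : ℂ :=
  Complex.exp (Complex.I * (Complex.arg (h.1 + h.2) : ℂ)) + (h.1 + h.2)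

@[fun_prop]
lemma measurable_scaleFactor : Measurable scaleFactor := by
  unfold scaleFactor
  have : Measurable fun h : ℂ × ℂ => (Complex.arg (h.1 + h.2) : ℂ) :=
    Complex.measurable_ofReal.comp (Complex.measurable_arg.comp (by fun_prop))
  fun_prop

/-- The two summands of ĝ have the same phase, so their moduli add. -/
lemma norm_scaleFactor (h : ℂ × ℂ) : ‖scaleFactor h‖ = 1 + ‖h.1 + h.2‖ := by
  rw [scaleFactor]
  set z := h.1 + h.2
  have hz : Complex.exp (Complex.I * (Complex.arg z : ℂ)) + z =
      ((1 + ‖z‖ : ℝ) : ℂ) * Complex.exp (Complex.arg z * Complex.I) := by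
    rw [mul_comm Complex.I]
    push_cast
    linear_combination -Complex.norm_mul_exp_arg_mul_I z
  rw [hz, norm_mul, Complex.norm_exp_ofReal_mul_I, mul_one, Complex.norm_real,
    Real.norm_of_nonneg (by positivity)]

lemma scaleFactor_ne_zero (h : ℂ × ℂ) : scaleFactor h ≠ 0 := by
  rw [← norm_pos_iff, norm_scaleFactor]
  positivity

/-- The fading cancels in g - ĝ, leaving a unit phase and the training noise. The bound thus does
not grow with r. -/
lemma norm_fst_sub_scaleFactor_le (h : ℂ × ℂ) : ‖h.1 - scaleFactor h‖ ≤ 1 + ‖h.2‖ := by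
  have : h.1 - scaleFactor h =
      -(Complex.exp (Complex.I * (Complex.arg (h.1 + h.2) : ℂ)) + h.2) := by
    rw [scaleFactor]
    ring
  rw [this, norm_neg]
  refine (norm_add_le _ _).trans ?_
  rw [mul_comm, Complex.norm_exp_ofReal_mul_I]

/-- The noise after scaling. -/
def scaledNoise (q : (ℂ × ℂ) × (Fin n → ℂ)) : Fin n → ℂ := (scaleFactor q.1)⁻¹ • q.2

/-- The scaled vector as a function of the input, of the fading pair, and of the noise. -/
def scaledOut (p : (Fin n → ℂ) × ((ℂ × ℂ) × (Fin n → ℂ))) : Fin n → ℂ :=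
  (scaleFactor p.2.1)⁻¹ • (p.2.1.1 • p.1 + p.2.2)

@[fun_prop]
lemma measurable_scaledNoise : Measurable (scaledNoise (n := n)) := by
  unfold scaledNoise
  fun_prop

@[fun_prop]
lemma measurable_scaledOut : Measurable (scaledOut (n := n)) := by
  unfold scaledOut
  fun_prop

/-- The joint law of the fading pair and of the noise. -/
abbrev noiseLaw (n : ℕ) (r : ℝ≥0) : Measure ((ℂ × ℂ) × (Fin n → ℂ)) :=
  (fadingLaw r).prod (stdComplexGaussianVec n)

/-- The joint law of the input, of the fading pair with the noise, and of an independent copy of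
the latter from which the quantization noise is formed. -/
abbrev canonicalLaw (n : ℕ) (r : ℝ≥0) :
    Measure (((Fin n → ℂ) × ((ℂ × ℂ) × (Fin n → ℂ))) × ((ℂ × ℂ) × (Fin n → ℂ))) :=
  ((stdComplexGaussianVec n).prod (noiseLaw n r)).prod (noiseLaw n r)

section Transfer

variable {Ω Ω' α β δ : Type*} [MeasurableSpace Ω] [MeasurableSpace Ω'] [MeasurableSpace α]
  [MeasurableSpace β] [MeasurableSpace δ]

lemma mutualInfo_comp (P : Measure Ω) {J : Ω → Ω'} (hJ : AEMeasurable J P) {U : Ω' → α}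
    {V : Ω' → β} (hU : Measurable U) (hV : Measurable V) :
    mutualInfo P (fun ω => U (J ω)) (fun ω => V (J ω)) = mutualInfo (P.map J) U V := by
  rw [mutualInfo, mutualInfo, AEMeasurable.map_map_of_aemeasurable (by fun_prop) hJ,
    AEMeasurable.map_map_of_aemeasurable (by fun_prop) hJ,
    AEMeasurable.map_map_of_aemeasurable (by fun_prop) hJ]
  rfl

lemma condDistrib_comp_map_eq [StandardBorelSpace α] [Nonempty α] (P : Measure Ω)
    [IsFiniteMeasure P] {J : Ω → Ω'} (hJ : AEMeasurable J P) {U : Ω' → α} {Z : Ω' → δ}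
    (hU : Measurable U) (hZ : Measurable Z) :
    condDistrib (fun ω => U (J ω)) (fun ω => Z (J ω)) P = condDistrib U Z (P.map J) := by
  have h : (P.map J).map (fun ω => (Z ω, U ω)) = P.map fun ω => (Z (J ω), U (J ω)) :=
    AEMeasurable.map_map_of_aemeasurable (by fun_prop) hJ
  rw [condDistrib, condDistrib]
  congr 1
  exact h.symm

lemma condMutualInfo_comp [StandardBorelSpace α] [Nonempty α] [StandardBorelSpace β] [Nonempty β]
    (P : Measure Ω) [IsFiniteMeasure P] {J : Ω → Ω'} (hJ : AEMeasurable J P) {U : Ω' → α}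
    {V : Ω' → β} {Z : Ω' → δ} (hU : Measurable U) (hV : Measurable V) (hZ : Measurable Z) :
    condMutualInfo P (fun ω => U (J ω)) (fun ω => V (J ω)) (fun ω => Z (J ω)) =
      condMutualInfo (P.map J) U V Z := by
  rw [condMutualInfo, condMutualInfo, condDistrib_comp_map_eq P hJ hU hZ,
    condDistrib_comp_map_eq P hJ hV hZ, AEMeasurable.map_map_of_aemeasurable (by fun_prop) hJ,
    AEMeasurable.map_map_of_aemeasurable (by fun_prop) hJ]
  rfl

end Transfer

variable {Ω : Type*} {g w' : Ω → ℂ} {X W Q : Ω → Fin n → ℂ}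

lemma scaled_eq (ω : Ω) : scaled g w' X W ω = scaledOut (X ω, ((g ω, w' ω), W ω)) := by
  ext i
  simp [scaled, received, scaledOut, gHat, scaleFactor, div_eq_inv_mul]

variable [MeasurableSpace Ω] {P : Measure Ω} {r : ℝ≥0}

lemma IsModel.aemeasurable_sources (hM : IsModel P r g w' X W Q) :
    AEMeasurable (fun ω => ((X ω, ((g ω, w' ω), W ω)), Q ω)) P := by
  have := hM.law_g.aemeasurable
  have := hM.law_w'.aemeasurable
  have := hM.law_X.aemeasurable
  have := hM.law_W.aemeasurable
  have := hM.law_Q.aemeasurable_fst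
  fun_prop

variable [IsProbabilityMeasure P]

/-- The independence assumptions turn the joint law into a product, and `Q`, known only through its
law, may be taken to be the scaled noise of a second independent copy. Both informations depend only
on this joint law. -/
lemma IsModel.map_sources (hM : IsModel P r g w' X W Q) :
    P.map (fun ω => ((X ω, ((g ω, w' ω), W ω)), Q ω)) =
      (canonicalLaw n r).map (Prod.map id scaledNoise) := by
  have mg := hM.law_g.aemeasurable
  have mw' := hM.law_w'.aemeasurable
  have mX := hM.law_X.aemeasurable
  have mW := hM.law_W.aemeasurable
  have mQ := hM.law_Q.aemeasurable_fst
  have hgw : P.map (fun ω => (g ω, w' ω)) = fadingLaw r := by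
    rw [(indepFun_iff_map_prod_eq_prod_map_map mg mw').mp hM.indep_w', hM.law_g.map_eq,
      hM.law_w'.map_eq, fadingLaw]
  have iW : IndepFun (fun ω => (g ω, w' ω)) W P :=
    hM.indep_W.comp (φ := fun t : ℂ × ℂ × (Fin n → ℂ) => (t.1, t.2.1)) (by fun_prop)
      measurable_id
  have hN : P.map (fun ω => ((g ω, w' ω), W ω)) = noiseLaw n r := by
    rw [(indepFun_iff_map_prod_eq_prod_map_map (by fun_prop) mW).mp iW, hgw, hM.law_W.map_eq]
  have hQ : P.map Q = (noiseLaw n r).map scaledNoise := by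
    rw [hM.law_Q.map_eq, ← hN, AEMeasurable.map_map_of_aemeasurable (by fun_prop) (by fun_prop)]
    congr 1
    ext ω i
    simp [scaledNoise, gHat, scaleFactor, div_eq_inv_mul]
  have iXW : IndepFun (fun ω => ((g ω, w' ω), X ω)) W P :=
    hM.indep_W.comp (φ := fun t : ℂ × ℂ × (Fin n → ℂ) => ((t.1, t.2.1), t.2.2)) (by fun_prop)
      measurable_id
  have h3 : P.map (fun ω => (((g ω, w' ω), X ω), W ω)) =
      ((fadingLaw r).prod (stdComplexGaussianVec n)).prod (stdComplexGaussianVec n) := by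
    rw [(indepFun_iff_map_prod_eq_prod_map_map (by fun_prop) mW).mp iXW,
      (indepFun_iff_map_prod_eq_prod_map_map (by fun_prop) mX).mp hM.indep_X, hgw,
      hM.law_W.map_eq, hM.law_X.map_eq]
  have h4 : P.map (fun ω => (X ω, ((g ω, w' ω), W ω))) =
      (stdComplexGaussianVec n).prod (noiseLaw n r) := by
    have hmp : MeasurePreserving
        (fun t : ((ℂ × ℂ) × (Fin n → ℂ)) × (Fin n → ℂ) => (t.1.2, (t.1.1, t.2)))
        (((fadingLaw r).prod (stdComplexGaussianVec n)).prod (stdComplexGaussianVec n))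
        ((stdComplexGaussianVec n).prod (noiseLaw n r)) :=
      (measurePreserving_prodAssoc (stdComplexGaussianVec n) (fadingLaw r)
        (stdComplexGaussianVec n)).comp
        ((Measure.measurePreserving_swap (μ := fadingLaw r) (ν := stdComplexGaussianVec n)).prod
          (MeasurePreserving.id (stdComplexGaussianVec n)))
    rw [← hmp.map_eq, ← h3, AEMeasurable.map_map_of_aemeasurable (by fun_prop) (by fun_prop)]
    rfl
  have iQ : IndepFun (fun ω => (X ω, ((g ω, w' ω), W ω))) Q P :=
    hM.indep_Q.comp (φ := fun t : ℂ × ℂ × (Fin n → ℂ) × (Fin n → ℂ) =>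
      (t.2.2.1, ((t.1, t.2.1), t.2.2.2))) (by fun_prop) measurable_id
  rw [(indepFun_iff_map_prod_eq_prod_map_map (by fun_prop) mQ).mp iQ, h4, hQ,
    ← Measure.map_prod_map _ _ measurable_id measurable_scaledNoise, Measure.map_id]

/-- The quantized vector on the canonical space. -/
def quantOut (p : ((Fin n → ℂ) × ((ℂ × ℂ) × (Fin n → ℂ))) × ((ℂ × ℂ) × (Fin n → ℂ))) :
    Fin n → ℂ :=
  scaledOut p.1 + scaledNoise p.2

@[fun_prop]
lemma measurable_quantOut : Measurable (quantOut (n := n)) := by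
  unfold quantOut
  fun_prop

lemma IsModel.mutualInfo_eq (hM : IsModel P r g w' X W Q) :
    mutualInfo P (quantized g w' X W Q) X =
      mutualInfo (canonicalLaw n r) quantOut (fun p => p.1.1) := by
  have h1 := mutualInfo_comp P hM.aemeasurable_sources
    (U := fun t => scaledOut t.1 + t.2) (V := fun t => t.1.1) (by fun_prop) (by fun_prop)
  have h2 := mutualInfo_comp (canonicalLaw n r) (J := Prod.map id scaledNoise)
    (Measurable.aemeasurable (by fun_prop))
    (U := fun t => scaledOut t.1 + t.2) (V := fun t => t.1.1) (by fun_prop) (by fun_prop)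
  rw [hM.map_sources, ← h2] at h1
  refine Eq.trans ?_ h1
  congr 1
  ext ω i
  simp [quantized, scaled_eq]

lemma IsModel.condMutualInfo_eq (hM : IsModel P r g w' X W Q) :
    condMutualInfo P (quantized g w' X W Q) (scaled g w' X W) X =
      condMutualInfo (canonicalLaw n r) quantOut (fun p => scaledOut p.1) (fun p => p.1.1) := by
  have h1 := condMutualInfo_comp P hM.aemeasurable_sources
    (U := fun t => scaledOut t.1 + t.2) (V := fun t => scaledOut t.1) (Z := fun t => t.1.1)
    (by fun_prop) (by fun_prop) (by fun_prop)
  have h2 := condMutualInfo_comp (canonicalLaw n r) (J := Prod.map id scaledNoise)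
    (Measurable.aemeasurable (by fun_prop))
    (U := fun t => scaledOut t.1 + t.2) (V := fun t => scaledOut t.1) (Z := fun t => t.1.1)
    (by fun_prop) (by fun_prop) (by fun_prop)
  have h3 : condMutualInfo (P.map (fun ω => ((X ω, ((g ω, w' ω), W ω)), Q ω)))
      (fun t => scaledOut t.1 + t.2) (fun t => scaledOut t.1) (fun t => t.1.1) =
      condMutualInfo ((canonicalLaw n r).map (Prod.map id scaledNoise))
      (fun t => scaledOut t.1 + t.2) (fun t => scaledOut t.1) (fun t => t.1.1) := by
    simp only [hM.map_sources]
  refine Eq.trans ?_ (h1.trans (h3.trans h2.symm))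
  congr 1
  · ext ω i
    simp [quantized, scaled_eq]
  · ext ω i
    simp [scaled_eq]

end Canonical

/-! ### Distortion and the three information bounds -/

section Bounds

lemma integrable_of_lintegral_ofReal_le {α : Type*} [MeasurableSpace α] {μ : Measure α}
    {f : α → ℝ} {b : ℝ} (hf : Measurable f) (h0 : ∀ x, 0 ≤ f x)
    (h : ∫⁻ x, ENNReal.ofReal (f x) ∂μ ≤ ENNReal.ofReal b) : Integrable f μ := by
  refine ⟨hf.aestronglyMeasurable, ?_⟩
  rw [hasFiniteIntegral_iff_ofReal (ae_of_all _ h0)]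
  exact h.trans_lt ENNReal.ofReal_lt_top

lemma integral_le_of_lintegral_ofReal_le {α : Type*} [MeasurableSpace α] {μ : Measure α}
    {f : α → ℝ} {b : ℝ} (hf : Measurable f) (h0 : ∀ x, 0 ≤ f x) (hb : 0 ≤ b)
    (h : ∫⁻ x, ENNReal.ofReal (f x) ∂μ ≤ ENNReal.ofReal b) : ∫ x, f x ∂μ ≤ b := by
  rw [integral_eq_lintegral_of_nonneg_ae (ae_of_all _ h0) hf.aestronglyMeasurable]
  exact ENNReal.toReal_le_of_le_ofReal hb h

variable {n : ℕ}

lemma integrable_normSqSum_stdComplexGaussianVec :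
    Integrable normSqSum (stdComplexGaussianVec n) :=
  integrable_of_lintegral_ofReal_le (b := n) measurable_normSqSum normSqSum_nonneg
    (by rw [lintegral_normSqSum_stdComplexGaussianVec, ENNReal.ofReal_natCast])

/-- A bound on the divergence between two laws of the form `affineGaussian`, from bounds on the
expected logarithm of the ratio of scales and on the normalized second moment. -/
lemma klDiv_affineGaussian_le {α : Type*} [MeasurableSpace α] {μ : Measure α}
    [IsProbabilityMeasure μ] {m m' : α → Fin n → ℂ} {c c' : α → ℂ} (hm : Measurable m)
    (hm' : Measurable m') (hc : Measurable c) (hc' : Measurable c') (hc0 : ∀ a, c a ≠ 0)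
    (hc0' : ∀ a, c' a ≠ 0) {A B : ℝ}
    (hlog : Integrable (fun a => Real.log ‖c' a‖ - Real.log ‖c a‖) μ)
    (hA : ∫ a, (Real.log ‖c' a‖ - Real.log ‖c a‖) ∂μ ≤ A) (hB0 : 0 ≤ B)
    (hB : ∫⁻ p, ENNReal.ofReal (normSqSum ((c' p.1)⁻¹ • (m p.1 + c p.1 • p.2 - m' p.1)))
      ∂μ.prod (stdComplexGaussianVec n) ≤ ENNReal.ofReal B) :
    klDiv (affineGaussian μ m c) (affineGaussian μ m' c') ≤
      ENNReal.ofReal (2 * n * A + B) := by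
  have hmap : Measurable fun p : α × (Fin n → ℂ) => (p.1, m p.1 + c p.1 • p.2) := by fun_prop
  have hllr := measurable_gaussianLLR hm hm' hc hc'
  have hrw : ∀ p : α × (Fin n → ℂ), gaussianLLR m m' c c' (p.1, m p.1 + c p.1 • p.2) =
      2 * n * (Real.log ‖c' p.1‖ - Real.log ‖c p.1‖) - normSqSum p.2 +
        normSqSum ((c' p.1)⁻¹ • (m p.1 + c p.1 • p.2 - m' p.1)) := by
    intro p
    rw [gaussianLLR]
    simp only [add_sub_cancel_left, inv_smul_smul₀ (hc0 p.1)]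
    ring
  have h1 : Integrable (fun p : α × (Fin n → ℂ) => 2 * n * (Real.log ‖c' p.1‖ - Real.log ‖c p.1‖))
      (μ.prod (stdComplexGaussianVec n)) := (hlog.comp_fst _).const_mul _
  have h2 : Integrable (fun p : α × (Fin n → ℂ) => normSqSum p.2)
      (μ.prod (stdComplexGaussianVec n)) :=
    integrable_normSqSum_stdComplexGaussianVec.comp_snd _
  have h3 : Integrable (fun p : α × (Fin n → ℂ) =>
      normSqSum ((c' p.1)⁻¹ • (m p.1 + c p.1 • p.2 - m' p.1)))
      (μ.prod (stdComplexGaussianVec n)) :=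
    integrable_of_lintegral_ofReal_le (by fun_prop) (fun _ => normSqSum_nonneg _) hB
  have hint : Integrable (gaussianLLR m m' c c') (affineGaussian μ m c) := by
    rw [affineGaussian, integrable_map_measure hllr.aestronglyMeasurable hmap.aemeasurable]
    refine ((h1.sub h2).add h3).congr (ae_of_all _ fun p => ?_)
    exact (hrw p).symm
  rw [klDiv_affineGaussian hm hm' hc hc' hc0 hc0' hint]
  refine ENNReal.ofReal_le_ofReal ?_
  rw [affineGaussian, integral_map hmap.aemeasurable hllr.aestronglyMeasurable]
  simp_rw [hrw]
  have h12 : Integrable (fun p : α × (Fin n → ℂ) =>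
      2 * n * (Real.log ‖c' p.1‖ - Real.log ‖c p.1‖) - normSqSum p.2)
      (μ.prod (stdComplexGaussianVec n)) := h1.sub h2
  rw [integral_add h12 h3, integral_sub h1 h2, integral_const_mul,
    integral_fun_fst (fun a => Real.log ‖c' a‖ - Real.log ‖c a‖)]
  -- This integral enters with a minus sign and is dropped, at the cost of a constant.
  have h4 : 0 ≤ ∫ p : α × (Fin n → ℂ), normSqSum p.2 ∂μ.prod (stdComplexGaussianVec n) :=
    integral_nonneg fun _ => normSqSum_nonneg _
  have h5 := integral_le_of_lintegral_ofReal_le (by fun_prop) (fun _ => normSqSum_nonneg _) hB0 hB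
  have h6 : 2 * (n : ℝ) * ∫ a, (Real.log ‖c' a‖ - Real.log ‖c a‖) ∂μ ≤ 2 * n * A := by gcongr
  simp only [probReal_univ, one_smul]
  linarith

lemma klDiv_map_affineGaussian_le {α β : Type*} [MeasurableSpace α] [MeasurableSpace β]
    {μ : Measure α} [IsProbabilityMeasure μ] {m m' : α → Fin n → ℂ} {c c' : α → ℂ}
    (hm : Measurable m) (hm' : Measurable m') (hc : Measurable c) (hc' : Measurable c')
    {Φ : α × (Fin n → ℂ) → β} (hΦ : Measurable Φ) :
    klDiv ((affineGaussian μ m c).map Φ) ((affineGaussian μ m' c').map Φ) ≤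
      klDiv (affineGaussian μ m c) (affineGaussian μ m' c') := by
  have := isProbabilityMeasure_affineGaussian (μ := μ) hm hc
  have := isProbabilityMeasure_affineGaussian (μ := μ) hm' hc'
  exact klDiv_map_le _ _ hΦ

variable {r : ℝ≥0}

lemma lintegral_normSqSum_scaledNoise_le (hr : 0 < r) :
    ∫⁻ q, ENNReal.ofReal (normSqSum (scaledNoise q)) ∂noiseLaw n r ≤
      n * ENNReal.ofReal ((logFactor r / r) ^ 2) := by
  have h : ∀ q : (ℂ × ℂ) × (Fin n → ℂ), ENNReal.ofReal (normSqSum (scaledNoise q)) =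
      ENNReal.ofReal (((1 + ‖q.1.1 + q.1.2‖) ^ 2)⁻¹) * ENNReal.ofReal (normSqSum q.2) := by
    intro q
    rw [← ENNReal.ofReal_mul (by positivity), scaledNoise, normSqSum_smul, norm_inv,
      norm_scaleFactor, inv_pow]
  simp_rw [h]
  rw [lintegral_prod_mul (f := fun h : ℂ × ℂ => ENNReal.ofReal (((1 + ‖h.1 + h.2‖) ^ 2)⁻¹))
    (g := fun w => ENNReal.ofReal (normSqSum w)) (by fun_prop) (by fun_prop),
    lintegral_normSqSum_stdComplexGaussianVec, mul_comm]
  gcongr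
  simpa using lintegral_inv_sq_fadingLaw_le hr (f := fun _ => 1) measurable_const

/-- The contribution of the scaling error to the distortion. -/
lemma lintegral_normSqSum_scalingError_le (hr : 0 < r) :
    ∫⁻ t : (Fin n → ℂ) × (ℂ × ℂ), ENNReal.ofReal
        (normSqSum (((scaleFactor t.2)⁻¹ * (t.2.1 - scaleFactor t.2)) • t.1))
        ∂(stdComplexGaussianVec n).prod (fadingLaw r) ≤
      n * (4 * ENNReal.ofReal ((logFactor r / r) ^ 2)) := by
  have h : ∀ t : (Fin n → ℂ) × (ℂ × ℂ), ENNReal.ofReal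
      (normSqSum (((scaleFactor t.2)⁻¹ * (t.2.1 - scaleFactor t.2)) • t.1)) ≤
      ENNReal.ofReal (normSqSum t.1) * ((2 + 2 * ENNReal.ofReal (‖t.2.2‖ ^ 2)) *
        ENNReal.ofReal (((1 + ‖t.2.1 + t.2.2‖) ^ 2)⁻¹)) := by
    intro t
    have e2 : (2 : ℝ≥0∞) = ENNReal.ofReal 2 := by norm_num
    rw [e2, ← ENNReal.ofReal_mul (by norm_num), ← ENNReal.ofReal_add (by norm_num) (by positivity),
      ← ENNReal.ofReal_mul (by positivity), ← ENNReal.ofReal_mul (normSqSum_nonneg _),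
      normSqSum_smul, norm_mul, norm_inv, norm_scaleFactor, mul_pow, inv_pow, mul_comm]
    refine ENNReal.ofReal_le_ofReal (mul_le_mul_of_nonneg_left ?_ (normSqSum_nonneg _))
    rw [mul_comm]
    refine mul_le_mul_of_nonneg_right ?_ (by positivity)
    have := norm_fst_sub_scaleFactor_le t.2
    nlinarith [norm_nonneg (t.2.1 - scaleFactor t.2), norm_nonneg t.2.2, sq_nonneg (‖t.2.2‖ - 1)]
  refine (lintegral_mono h).trans ?_
  rw [lintegral_prod_mul (f := fun x : Fin n → ℂ => ENNReal.ofReal (normSqSum x))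
    (g := fun h : ℂ × ℂ => (2 + 2 * ENNReal.ofReal (‖h.2‖ ^ 2)) *
        ENNReal.ofReal (((1 + ‖h.1 + h.2‖) ^ 2)⁻¹)) (by fun_prop) (by fun_prop),
    lintegral_normSqSum_stdComplexGaussianVec]
  gcongr
  refine (lintegral_inv_sq_fadingLaw_le hr (f := fun w => 2 + 2 * ENNReal.ofReal (‖w‖ ^ 2))
    (by fun_prop)).trans ?_
  gcongr
  rw [lintegral_add_left (by fun_prop), lintegral_const_mul _ (by fun_prop),
    lintegral_norm_sq_complexGaussian]
  simp
  norm_num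

/-- Separates the estimation error into the relative scaling error g/ĝ - 1 acting on the input, the
scaled channel noise and the quantization noise. -/
lemma quantOut_sub_eq
    (p : ((Fin n → ℂ) × ((ℂ × ℂ) × (Fin n → ℂ))) × ((ℂ × ℂ) × (Fin n → ℂ))) :
    quantOut p - p.1.1 =
      ((scaleFactor p.1.2.1)⁻¹ * (p.1.2.1.1 - scaleFactor p.1.2.1)) • p.1.1
        + scaledNoise p.1.2 + scaledNoise p.2 := by
  ext i
  have := scaleFactor_ne_zero p.1.2.1
  simp only [quantOut, scaledOut, scaledNoise, Pi.sub_apply, Pi.add_apply, Pi.smul_apply,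
    smul_eq_mul]
  field_simp
  ring

/-- The mean square error of the quantized vector as an estimate of the input. -/
lemma lintegral_normSqSum_quantOut_sub_le (hr : 0 < r) :
    ∫⁻ p, ENNReal.ofReal (normSqSum (quantOut p - p.1.1)) ∂canonicalLaw n r ≤
      ENNReal.ofReal (18 * n * (logFactor r / r) ^ 2) := by
  set b := ENNReal.ofReal ((logFactor r / r) ^ 2) with hb
  have hle : ∀ p : ((Fin n → ℂ) × ((ℂ × ℂ) × (Fin n → ℂ))) × ((ℂ × ℂ) × (Fin n → ℂ)),
      ENNReal.ofReal (normSqSum (quantOut p - p.1.1)) ≤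
        3 * ENNReal.ofReal (normSqSum
          (((scaleFactor p.1.2.1)⁻¹ * (p.1.2.1.1 - scaleFactor p.1.2.1)) • p.1.1))
        + 3 * ENNReal.ofReal (normSqSum (scaledNoise p.1.2))
        + 3 * ENNReal.ofReal (normSqSum (scaledNoise p.2)) := by
    intro p
    have e3 : (3 : ℝ≥0∞) = ENNReal.ofReal 3 := by norm_num
    have h0 := fun x : Fin n → ℂ => mul_nonneg (by norm_num : (0 : ℝ) ≤ 3) (normSqSum_nonneg x)
    rw [e3, ← ENNReal.ofReal_mul (by norm_num), ← ENNReal.ofReal_mul (by norm_num),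
      ← ENNReal.ofReal_mul (by norm_num), ← ENNReal.ofReal_add (h0 _) (h0 _),
      ← ENNReal.ofReal_add (add_nonneg (h0 _) (h0 _)) (h0 _), quantOut_sub_eq]
    exact ENNReal.ofReal_le_ofReal (normSqSum_add_add_le _ _ _)
  have i1 : ∫⁻ p, ENNReal.ofReal (normSqSum
      (((scaleFactor p.1.2.1)⁻¹ * (p.1.2.1.1 - scaleFactor p.1.2.1)) • p.1.1))
      ∂canonicalLaw n r ≤ n * (4 * b) := by
    have hmp : MeasurePreserving
        (fun p : ((Fin n → ℂ) × ((ℂ × ℂ) × (Fin n → ℂ))) × ((ℂ × ℂ) × (Fin n → ℂ)) =>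
          (p.1.1, p.1.2.1)) (canonicalLaw n r)
        ((stdComplexGaussianVec n).prod (fadingLaw r)) :=
      ((MeasurePreserving.id _).prod measurePreserving_fst).comp measurePreserving_fst
    exact (hmp.lintegral_comp (f := fun t => ENNReal.ofReal
      (normSqSum (((scaleFactor t.2)⁻¹ * (t.2.1 - scaleFactor t.2)) • t.1)))
      (by fun_prop)).trans_le (lintegral_normSqSum_scalingError_le hr)
  have i2 : ∫⁻ p, ENNReal.ofReal (normSqSum (scaledNoise p.1.2)) ∂canonicalLaw n r ≤ n * b := by
    have hmp : MeasurePreserving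
        (fun p : ((Fin n → ℂ) × ((ℂ × ℂ) × (Fin n → ℂ))) × ((ℂ × ℂ) × (Fin n → ℂ)) => p.1.2)
        (canonicalLaw n r) (noiseLaw n r) := measurePreserving_snd.comp measurePreserving_fst
    exact (hmp.lintegral_comp (f := fun q => ENNReal.ofReal (normSqSum (scaledNoise q)))
      (by fun_prop)).trans_le (lintegral_normSqSum_scaledNoise_le hr)
  have i3 : ∫⁻ p, ENNReal.ofReal (normSqSum (scaledNoise p.2)) ∂canonicalLaw n r ≤ n * b := by
    have hmp : MeasurePreserving
        (fun p : ((Fin n → ℂ) × ((ℂ × ℂ) × (Fin n → ℂ))) × ((ℂ × ℂ) × (Fin n → ℂ)) => p.2)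
        (canonicalLaw n r) (noiseLaw n r) := measurePreserving_snd
    exact (hmp.lintegral_comp (f := fun q => ENNReal.ofReal (normSqSum (scaledNoise q)))
      (by fun_prop)).trans_le (lintegral_normSqSum_scaledNoise_le hr)
  refine (lintegral_mono hle).trans ?_
  rw [lintegral_add_left (by fun_prop), lintegral_add_left (by fun_prop),
    lintegral_const_mul _ (by fun_prop), lintegral_const_mul _ (by fun_prop),
    lintegral_const_mul _ (by fun_prop)]
  calc _ ≤ 3 * (n * (4 * b)) + 3 * (n * b) + 3 * (n * b) := by gcongr
    -- 18 = 3 (4 + 1 + 1): the 3 is the cost of splitting the squared norm, the 4 comes from the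
    -- scaling error.
    _ = 18 * n * b := by ring
    _ = _ := by
      rw [ENNReal.ofReal_mul (by positivity), ENNReal.ofReal_mul (by norm_num),
        ENNReal.ofReal_natCast, ENNReal.ofReal_ofNat]

/-- The mutual information (in nats) is bounded by that of a Gaussian channel with known fading. -/
lemma klDiv_quantOut_input_le :
    klDiv ((canonicalLaw n r).map fun p => (quantOut p, p.1.1))
        (((canonicalLaw n r).map quantOut).prod ((canonicalLaw n r).map fun p => p.1.1)) ≤
      ENNReal.ofReal (n * Real.log (1 + (r : ℝ) ^ 2) + 2 * n) := by
  set N := noiseLaw n r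
  set G := fadingLaw r
  set m := stdComplexGaussianVec n with hm
  -- `t ^ 2` is the variance of each entry of Y = g X + W.
  set t : ℝ := √(1 + (r : ℝ) ^ 2) with ht
  have ht2 : t ^ 2 = 1 + (r : ℝ) ^ 2 := Real.sq_sqrt (by positivity)
  have ht0 : 0 < t := Real.sqrt_pos.mpr (by positivity)
  have htc : (t : ℂ) ≠ 0 := by exact_mod_cast ht0.ne'
  set μ : Measure ((Fin n → ℂ) × ((ℂ × ℂ) × ((ℂ × ℂ) × (Fin n → ℂ)))) := m.prod (G.prod N)
  set Φ : ((Fin n → ℂ) × ((ℂ × ℂ) × ((ℂ × ℂ) × (Fin n → ℂ)))) × (Fin n → ℂ) →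
      (Fin n → ℂ) × (Fin n → ℂ) :=
    fun s => ((scaleFactor s.1.2.1)⁻¹ • s.2 + scaledNoise s.1.2.2, s.1.1) with hΦ
  have mΦ : Measurable Φ := by fun_prop
  -- Moves the channel noise to the last coordinate: given everything else, Y is then Gaussian with
  -- mean g X and unit variance.
  have hre : MeasurePreserving
      (fun p : ((Fin n → ℂ) × ((ℂ × ℂ) × (Fin n → ℂ))) × ((ℂ × ℂ) × (Fin n → ℂ)) =>
        ((p.1.1, (p.1.2.1, p.2)), p.1.2.2)) (canonicalLaw n r) (μ.prod m) := by
    have hin : MeasurePreserving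
        (fun q : ((ℂ × ℂ) × (Fin n → ℂ)) × ((ℂ × ℂ) × (Fin n → ℂ)) => ((q.1.1, q.2), q.1.2))
        (N.prod N) ((G.prod N).prod m) :=
      (measurePreserving_prodAssoc G N m).symm.comp
        (((MeasurePreserving.id G).prod Measure.measurePreserving_swap).comp
          (measurePreserving_prodAssoc G m N))
    exact (measurePreserving_prodAssoc m (G.prod N) m).symm.comp
      (((MeasurePreserving.id m).prod hin).comp (measurePreserving_prodAssoc m N N))
  have hjoint : (canonicalLaw n r).map (fun p => (quantOut p, p.1.1)) =
      (affineGaussian μ (fun a => a.2.1.1 • a.1) (fun _ => 1)).map Φ := by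
    rw [affineGaussian, ← hm, ← hre.map_eq, Measure.map_map (by fun_prop) hre.measurable,
      Measure.map_map mΦ (by fun_prop)]
    congr 1
    ext p i
    · simp [quantOut, hΦ, scaledOut]
    · rfl
  -- The competing output law: scaling and quantization are kept, but Y is replaced by `t` times a
  -- fresh standard vector. The input does not appear, so the reference law is a product.
  set f : ((ℂ × ℂ) × ((ℂ × ℂ) × (Fin n → ℂ))) × (Fin n → ℂ) → Fin n → ℂ :=
    fun b => (scaleFactor b.1.1)⁻¹ • ((t : ℂ) • b.2) + scaledNoise b.1.2 with hf
  have mf : Measurable f := by fun_prop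
  have : IsProbabilityMeasure (((G.prod N).prod m).map f) :=
    Measure.isProbabilityMeasure_map mf.aemeasurable
  have hX : (canonicalLaw n r).map (fun p => p.1.1) = m :=
    ((measurePreserving_fst (μ := m) (ν := N)).comp
      (measurePreserving_fst (μ := m.prod N) (ν := N))).map_eq
  have href : (((G.prod N).prod m).map f).prod ((canonicalLaw n r).map fun p => p.1.1) =
      (affineGaussian μ (fun _ => 0) (fun _ => (t : ℂ))).map Φ := by
    have hsw : MeasurePreserving
        (fun s : ((Fin n → ℂ) × ((ℂ × ℂ) × ((ℂ × ℂ) × (Fin n → ℂ)))) × (Fin n → ℂ) =>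
          ((s.1.2, s.2), s.1.1)) (μ.prod m) (((G.prod N).prod m).prod m) :=
      Measure.measurePreserving_swap.comp (measurePreserving_prodAssoc m (G.prod N) m)
    rw [hX, affineGaussian, Measure.map_map mΦ (by fun_prop)]
    conv_lhs => rw [← Measure.map_id (μ := m)]
    rw [Measure.map_prod_map _ _ mf measurable_id, Measure.map_id, ← hsw.map_eq,
      Measure.map_map (by fun_prop) hsw.measurable]
    congr 1
    ext p i
    · simp [hΦ, hf]
    · rfl
  refine (klDiv_prod_map_le (canonicalLaw n r) (by fun_prop) (by fun_prop)
    (((G.prod N).prod m).map f)).trans ?_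
  rw [hjoint, href]
  refine (klDiv_map_affineGaussian_le (by fun_prop) (by fun_prop) (by fun_prop) (by fun_prop)
    mΦ).trans ?_
  have hn : ‖(t : ℂ)‖ = t := by rw [Complex.norm_real, Real.norm_of_nonneg ht0.le]
  -- The normalized second moment of Y is n; `B` is twice that because of the factor 2 in
  -- `normSqSum_add_le`.
  refine (klDiv_affineGaussian_le (m := fun a => a.2.1.1 • a.1) (m' := fun _ => 0)
    (c := fun _ => 1) (c' := fun _ => (t : ℂ)) (μ := μ) (A := Real.log t) (B := 2 * n) (by fun_prop) (by fun_prop)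
    (by fun_prop) (by fun_prop) (fun _ => one_ne_zero) (fun _ => htc) (integrable_const _)
    (by simp [Complex.norm_real, abs_of_pos ht0]) (by positivity) ?_).trans ?_
  · have hle : ∀ p : ((Fin n → ℂ) × ((ℂ × ℂ) × ((ℂ × ℂ) × (Fin n → ℂ)))) × (Fin n → ℂ),
        ENNReal.ofReal (normSqSum ((t : ℂ)⁻¹ •
          (p.1.2.1.1 • p.1.1 + (1 : ℂ) • p.2 - (0 : Fin n → ℂ)))) ≤
        ENNReal.ofReal ((t ^ 2)⁻¹ * 2) * (ENNReal.ofReal (‖p.1.2.1.1‖ ^ 2) *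
          ENNReal.ofReal (normSqSum p.1.1) + ENNReal.ofReal (normSqSum p.2)) := by
      intro p
      rw [← ENNReal.ofReal_mul (by positivity), ← ENNReal.ofReal_add
        (mul_nonneg (by positivity) (normSqSum_nonneg _)) (normSqSum_nonneg _),
        ← ENNReal.ofReal_mul (by positivity), one_smul, sub_zero, normSqSum_smul, norm_inv, hn,
        inv_pow, mul_assoc]
      refine ENNReal.ofReal_le_ofReal (mul_le_mul_of_nonneg_left ?_ (by positivity))
      refine (normSqSum_add_le _ _).trans ?_
      rw [normSqSum_smul, mul_add]
    refine (lintegral_mono hle).trans ?_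
    have hg : ∫⁻ h : ℂ × ℂ, ENNReal.ofReal (‖h.1‖ ^ 2) ∂G = ((r ^ 2 : ℝ≥0) : ℝ≥0∞) := by
      rw [← lintegral_norm_sq_complexGaussian]
      exact (measurePreserving_fst (μ := complexGaussian (r ^ 2))
        (ν := complexGaussian 1)).lintegral_comp (f := fun z => ENNReal.ofReal (‖z‖ ^ 2))
        (by fun_prop)
    have i1 : ∫⁻ p : ((Fin n → ℂ) × ((ℂ × ℂ) × ((ℂ × ℂ) × (Fin n → ℂ)))) × (Fin n → ℂ),
        ENNReal.ofReal (‖p.1.2.1.1‖ ^ 2) * ENNReal.ofReal (normSqSum p.1.1) ∂μ.prod m =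
        n * ((r ^ 2 : ℝ≥0) : ℝ≥0∞) := by
      have hmp : MeasurePreserving
          (fun p : ((Fin n → ℂ) × ((ℂ × ℂ) × ((ℂ × ℂ) × (Fin n → ℂ)))) × (Fin n → ℂ) =>
            (p.1.1, p.1.2.1)) (μ.prod m) (m.prod G) :=
        ((MeasurePreserving.id m).prod measurePreserving_fst).comp measurePreserving_fst
      rw [hmp.lintegral_comp (f := fun s : (Fin n → ℂ) × (ℂ × ℂ) =>
        ENNReal.ofReal (‖s.2.1‖ ^ 2) * ENNReal.ofReal (normSqSum s.1)) (by fun_prop)]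
      simp_rw [mul_comm (ENNReal.ofReal (‖_‖ ^ 2))]
      rw [lintegral_prod_mul (f := fun x : Fin n → ℂ => ENNReal.ofReal (normSqSum x))
        (g := fun h : ℂ × ℂ => ENNReal.ofReal (‖h.1‖ ^ 2)) (by fun_prop) (by fun_prop),
        lintegral_normSqSum_stdComplexGaussianVec, hg]
    have i2 : ∫⁻ p : ((Fin n → ℂ) × ((ℂ × ℂ) × ((ℂ × ℂ) × (Fin n → ℂ)))) × (Fin n → ℂ),
        ENNReal.ofReal (normSqSum p.2) ∂μ.prod m = n := by
      rw [← lintegral_normSqSum_stdComplexGaussianVec n]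
      exact measurePreserving_snd.lintegral_comp
        (f := fun x : Fin n → ℂ => ENNReal.ofReal (normSqSum x)) (by fun_prop)
    rw [lintegral_const_mul _ (by fun_prop), lintegral_add_left (by fun_prop), i1, i2]
    have : (n : ℝ≥0∞) * ((r ^ 2 : ℝ≥0) : ℝ≥0∞) + n = ENNReal.ofReal (n * t ^ 2) := by
      rw [ht2, mul_add, mul_one, add_comm, ENNReal.ofReal_add (by positivity) (by positivity),
        ENNReal.ofReal_mul (by positivity), ENNReal.ofReal_natCast,
        ← NNReal.coe_pow, ENNReal.ofReal_coe_nnreal]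
    rw [this, ← ENNReal.ofReal_mul (by positivity)]
    refine ENNReal.ofReal_le_ofReal (le_of_eq ?_)
    field_simp
  · refine ENNReal.ofReal_le_ofReal (le_of_eq ?_)
    rw [ht, Real.log_sqrt (by positivity)]
    ring

/-- Lower bound for the mutual information (in nats) by Gaussian guessing of the input. -/
lemma le_toReal_klDiv_quantOut_input (hr : 0 < r) :
    -(2 * n * Real.log (logFactor r / r)) - 18 * n ≤
      (klDiv ((canonicalLaw n r).map fun p => (quantOut p, p.1.1))
        (((canonicalLaw n r).map quantOut).prod
          ((canonicalLaw n r).map fun p => p.1.1))).toReal := by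
  set K := canonicalLaw n r
  set k : ℝ := logFactor r / r with hk
  have hk0 : 0 < k := div_pos (zero_lt_one.trans_le (one_le_logFactor r.2)) hr
  have hkc : (k : ℂ) ≠ 0 := by exact_mod_cast hk0.ne'
  have hkn : ‖(k : ℂ)‖ = k := by rw [Complex.norm_real, Real.norm_of_nonneg hk0.le]
  -- Finiteness is essential: an infinite divergence would have `toReal` equal to 0.
  have hfin := (klDiv_quantOut_input_le (n := n) (r := r)).trans_lt ENNReal.ofReal_lt_top
  have : IsProbabilityMeasure (K.map quantOut) :=
    Measure.isProbabilityMeasure_map (by fun_prop)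
  have : IsProbabilityMeasure (K.map fun p => (quantOut p, p.1.1)) :=
    Measure.isProbabilityMeasure_map (by fun_prop)
  have hX : K.map (fun p => p.1.1) = stdComplexGaussianVec n :=
    ((measurePreserving_fst (μ := stdComplexGaussianVec n) (ν := noiseLaw n r)).comp
      (measurePreserving_fst (ν := noiseLaw n r))).map_eq
  have href : (K.map quantOut).prod (K.map fun p => p.1.1) =
      affineGaussian (n := n) (K.map quantOut) (fun _ => 0) (fun _ => 1) := by
    rw [hX, affineGaussian]
    simp
  have := isProbabilityMeasure_affineGaussian (n := n) (μ := K.map quantOut)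
    (m := fun y => y) (c := fun _ => (k : ℂ)) measurable_id measurable_const
  have := isProbabilityMeasure_affineGaussian (n := n) (μ := K.map quantOut)
    (m := fun _ => 0) (c := fun _ => (1 : ℂ)) measurable_const measurable_const
  -- The trial law keeps the law of Ŷ and draws the input from CN(Ŷ, k²), with k matched to the root
  -- mean square error.
  have hη := affineGaussian_eq_withDensity_exp (n := n) (μ := K.map quantOut) (m := fun y => y)
    (m' := fun _ => 0) (c := fun _ => (k : ℂ)) (c' := fun _ => 1) measurable_id measurable_const
    measurable_const measurable_const (fun _ => hkc) (fun _ => one_ne_zero)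
  have mf := measurable_gaussianLLR (n := n) (m := fun y : Fin n → ℂ => y)
    (m' := fun _ => 0) (c := fun _ => (k : ℂ)) (c' := fun _ => 1) measurable_id measurable_const
    measurable_const measurable_const
  have hrw : ∀ p, gaussianLLR (n := n) (fun y : Fin n → ℂ => y) (fun _ => 0) (fun _ => (k : ℂ))
      (fun _ => 1) (quantOut p, p.1.1) =
      -(2 * n * Real.log k) - (k ^ 2)⁻¹ * normSqSum (quantOut p - p.1.1) + normSqSum p.1.1 := by
    intro p
    have : normSqSum (p.1.1 - quantOut p) = normSqSum (quantOut p - p.1.1) := by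
      simp [normSqSum, norm_sub_rev]
    rw [gaussianLLR]
    simp only [norm_one, Real.log_one, mul_zero, hkn, inv_one, sub_zero, one_smul, zero_sub]
    rw [normSqSum_smul, norm_inv, hkn, inv_pow, this]
  have hlin := lintegral_normSqSum_quantOut_sub_le (n := n) hr
  have i1 : Integrable (fun p => normSqSum (quantOut p - p.1.1)) K :=
    integrable_of_lintegral_ofReal_le (by fun_prop) (fun _ => normSqSum_nonneg _) hlin
  have h1 : ∫ p, normSqSum (quantOut p - p.1.1) ∂K ≤ 18 * n * k ^ 2 :=
    integral_le_of_lintegral_ofReal_le (by fun_prop) (fun _ => normSqSum_nonneg _)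
      (by positivity) hlin
  have i2 : Integrable (fun p : ((Fin n → ℂ) × ((ℂ × ℂ) × (Fin n → ℂ))) ×
      ((ℂ × ℂ) × (Fin n → ℂ)) => normSqSum p.1.1) K :=
    (integrable_normSqSum_stdComplexGaussianVec.comp_fst _).comp_fst _
  have mp : Measurable fun p : ((Fin n → ℂ) × ((ℂ × ℂ) × (Fin n → ℂ))) ×
      ((ℂ × ℂ) × (Fin n → ℂ)) => (quantOut p, p.1.1) := by fun_prop
  have i12 : Integrable (fun p =>
      -(2 * n * Real.log k) - (k ^ 2)⁻¹ * normSqSum (quantOut p - p.1.1)) K :=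
    (integrable_const _).sub (i1.const_mul _)
  have hint : Integrable (gaussianLLR (n := n) (fun y : Fin n → ℂ => y) (fun _ => 0)
      (fun _ => (k : ℂ)) (fun _ => 1)) (K.map fun p => (quantOut p, p.1.1)) := by
    rw [integrable_map_measure mf.aestronglyMeasurable mp.aemeasurable]
    exact (i12.add i2).congr (ae_of_all _ fun p => (hrw p).symm)
  rw [href] at hfin ⊢
  refine le_trans ?_ (integral_le_toReal_klDiv mf hη hint hfin.ne)
  rw [integral_map mp.aemeasurable mf.aestronglyMeasurable]
  simp_rw [hrw]
  rw [integral_add i12 i2,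
    integral_sub (integrable_const _) (i1.const_mul _), integral_const_mul]
  have h2 : 0 ≤ ∫ p : ((Fin n → ℂ) × ((ℂ × ℂ) × (Fin n → ℂ))) ×
      ((ℂ × ℂ) × (Fin n → ℂ)), normSqSum p.1.1 ∂K := integral_nonneg fun _ => normSqSum_nonneg _
  have h3 : (k ^ 2)⁻¹ * ∫ p, normSqSum (quantOut p - p.1.1) ∂K ≤ 18 * n := by
    rw [inv_mul_le_iff₀ (by positivity)]
    linarith
  simp only [integral_const, probReal_univ, one_smul]
  linarith

/-- Tangent-line bound for the logarithm at `a`. With `a` a bound on the second moment of |ĝ|, its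
expectation replaces Jensen's inequality and its right side also gives integrability. -/
lemma two_mul_log_norm_scaleFactor_le (h : ℂ × ℂ) {a : ℝ} (ha : 0 < a) :
    2 * Real.log ‖scaleFactor h‖ ≤ Real.log a + (1 + ‖h.1 + h.2‖) ^ 2 / a := by
  have hs : 0 < 1 + ‖h.1 + h.2‖ := by positivity
  have h1 := Real.log_le_sub_one_of_pos (show 0 < (1 + ‖h.1 + h.2‖) ^ 2 / a by positivity)
  rw [Real.log_div (by positivity) ha.ne', Real.log_pow] at h1
  rw [norm_scaleFactor]
  push_cast at h1
  linarith

/-- The conditional mutual information (in nats) grows at most doubly logarithmically in `r`. -/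
lemma klDiv_quantOut_scaledOut_le (hr : 0 < r) :
    klDiv ((canonicalLaw n r).map fun p => (p.1.1, (quantOut p, scaledOut p.1)))
        (((canonicalLaw n r).map fun p => p.1.1).compProd
          ((condDistrib quantOut (fun p => p.1.1) (canonicalLaw n r)).prod
            (condDistrib (fun p => scaledOut p.1) (fun p => p.1.1) (canonicalLaw n r)))) ≤
      ENNReal.ofReal (2 * n * Real.log (logFactor r / r)
        + n * Real.log (6 + 4 * (r : ℝ) ^ 2) + 19 * n) := by
  set K := canonicalLaw n r with hK
  set m := stdComplexGaussianVec n with hm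
  set G := fadingLaw r
  set k : ℝ := logFactor r / r with hk
  have hk0 : 0 < k := div_pos (zero_lt_one.trans_le (one_le_logFactor r.2)) hr
  have hkc : (k : ℂ) ≠ 0 := by exact_mod_cast hk0.ne'
  have hkn : ‖(k : ℂ)‖ = k := by rw [Complex.norm_real, Real.norm_of_nonneg hk0.le]
  have hinp : Measurable fun p : ((Fin n → ℂ) × ((ℂ × ℂ) × (Fin n → ℂ))) ×
      ((ℂ × ℂ) × (Fin n → ℂ)) => p.1.1 := by fun_prop
  -- The reference law of Ŷ given the input is CN(X, k²).
  refine (klDiv_compProd_condDistrib_le K (by fun_prop) (by fun_prop) hinp m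
    (r := fun p => p.1 + (k : ℂ) • p.2) (by fun_prop)).trans ?_
  set C : Measure ((Fin n → ℂ) × (Fin n → ℂ)) := (m.prod (noiseLaw n r)).map fun a =>
    (a.1, scaledOut a) with hC
  have : IsProbabilityMeasure C := Measure.isProbabilityMeasure_map (by fun_prop)
  have hCK : K.map (fun p => (p.1.1, scaledOut p.1)) = C := by
    rw [hC, ← (measurePreserving_fst (μ := m.prod (noiseLaw n r)) (ν := noiseLaw n r)).map_eq,
      Measure.map_map (by fun_prop) (by fun_prop)]
    rfl
  set Ψ : (((Fin n → ℂ) × (Fin n → ℂ)) × (ℂ × ℂ)) × (Fin n → ℂ) →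
    ((Fin n → ℂ) × (Fin n → ℂ)) × (Fin n → ℂ) := fun s => (s.1.1, s.2) with hΨ
  have mΨ : Measurable Ψ := by fun_prop
  -- The second copy is split into its fading pair and its Gaussian noise: given (X, Y') and that
  -- pair, Ŷ is Gaussian with mean Y' and scale 1/ĝ'. The projection `Ψ` later forgets the pair.
  have hre : MeasurePreserving
      (fun p : ((Fin n → ℂ) × ((ℂ × ℂ) × (Fin n → ℂ))) × ((ℂ × ℂ) × (Fin n → ℂ)) =>
        (((p.1.1, scaledOut p.1), p.2.1), p.2.2)) K ((C.prod G).prod m) :=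
    (measurePreserving_prodAssoc C G m).symm.comp
      ((Measurable.measurePreserving (f := fun a => (a.1, scaledOut a)) (by fun_prop)
        (m.prod (noiseLaw n r))).prod (MeasurePreserving.id (noiseLaw n r)))
  have hjoint : K.map (fun p => ((p.1.1, scaledOut p.1), quantOut p)) =
      (affineGaussian (C.prod G) (fun a => a.1.2) (fun a => (scaleFactor a.2)⁻¹)).map Ψ := by
    rw [affineGaussian, ← hm, ← hre.map_eq, Measure.map_map (by fun_prop) hre.measurable,
      Measure.map_map mΨ (by fun_prop)]
    rfl
  have href : (((K.map fun p => (p.1.1, scaledOut p.1)).prod m).map fun p =>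
        (p.1, p.1.1 + (k : ℂ) • p.2)) =
      (affineGaussian (C.prod G) (fun a => a.1.1) (fun _ => (k : ℂ))).map Ψ := by
    have hmp : MeasurePreserving
        (fun s : (((Fin n → ℂ) × (Fin n → ℂ)) × (ℂ × ℂ)) × (Fin n → ℂ) => (s.1.1, s.2))
        ((C.prod G).prod m) (C.prod m) := measurePreserving_fst.prod (MeasurePreserving.id m)
    rw [hCK, affineGaussian, ← hm, Measure.map_map mΨ (by fun_prop), ← hmp.map_eq,
      Measure.map_map (by fun_prop) hmp.measurable]
    rfl
  refine (le_of_eq (congrArg₂ klDiv hjoint href)).trans ((klDiv_map_affineGaussian_le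
    (by fun_prop) (by fun_prop) (by fun_prop) (by fun_prop) mΨ).trans ?_)
  set a : ℝ := 6 + 4 * (r : ℝ) ^ 2 with ha
  have ha0 : 0 < a := by positivity
  have hsq := lintegral_norm_add_sq_fadingLaw_le r
  have isq : Integrable (fun h : ℂ × ℂ => (1 + ‖h.1 + h.2‖) ^ 2) G :=
    integrable_of_lintegral_ofReal_le (by fun_prop) (fun _ => by positivity) hsq
  have hsq' : ∫ h : ℂ × ℂ, (1 + ‖h.1 + h.2‖) ^ 2 ∂G ≤ a :=
    integral_le_of_lintegral_ofReal_le (by fun_prop) (fun _ => by positivity) ha0.le hsq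
  have hlog0 : ∀ h : ℂ × ℂ, 0 ≤ Real.log ‖scaleFactor h‖ := fun h =>
    Real.log_nonneg (by rw [norm_scaleFactor]; linarith [norm_nonneg (h.1 + h.2)])
  have idom : Integrable (fun h : ℂ × ℂ =>
      (Real.log a + (1 + ‖h.1 + h.2‖) ^ 2 / a) / 2) G :=
    ((integrable_const _).add (isq.div_const _)).div_const _
  have ilog : Integrable (fun h : ℂ × ℂ => Real.log ‖scaleFactor h‖) G := by
    refine idom.mono' (Measurable.aestronglyMeasurable (by fun_prop)) (ae_of_all _ fun h => ?_)
    rw [Real.norm_of_nonneg (hlog0 h)]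
    linarith [two_mul_log_norm_scaleFactor_le h ha0]
  have hlog : ∫ h, Real.log ‖scaleFactor h‖ ∂G ≤ (Real.log a + 1) / 2 := by
    refine (integral_mono ilog idom fun h => ?_).trans ?_
    · simp only
      linarith [two_mul_log_norm_scaleFactor_le h ha0]
    · rw [integral_div, integral_add (integrable_const _) (isq.div_const _), integral_div]
      have : (∫ h : ℂ × ℂ, (1 + ‖h.1 + h.2‖) ^ 2 ∂G) / a ≤ 1 := (div_le_one ha0).mpr hsq'
      simp only [integral_const, probReal_univ, one_smul]
      linarith
  have hsub : ∀ s : ((Fin n → ℂ) × (Fin n → ℂ)) × (ℂ × ℂ),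
      Real.log ‖(k : ℂ)‖ - Real.log ‖(scaleFactor s.2)⁻¹‖ =
        Real.log k + Real.log ‖scaleFactor s.2‖ := by
    intro s
    rw [hkn, norm_inv, Real.log_inv, sub_neg_eq_add]
  refine (klDiv_affineGaussian_le (m := fun s => s.1.2) (m' := fun s => s.1.1)
    (c := fun s => (scaleFactor s.2)⁻¹) (c' := fun _ => (k : ℂ)) (μ := C.prod G)
    (A := Real.log k + (Real.log a + 1) / 2) (B := 18 * n)
    (by fun_prop) (by fun_prop) (by fun_prop) (by fun_prop)
    (fun s => inv_ne_zero (scaleFactor_ne_zero _)) (fun _ => hkc) ?_ ?_ (by positivity) ?_).trans ?_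
  · simp_rw [hsub]
    exact (integrable_const _).add (ilog.comp_snd _)
  · simp_rw [hsub]
    rw [integral_add (integrable_const _) (ilog.comp_snd _),
      integral_fun_snd (fun h => Real.log ‖scaleFactor h‖)]
    simp only [integral_const, probReal_univ, one_smul]
    linarith
  · have hlin := lintegral_normSqSum_quantOut_sub_le (n := n) hr
    rw [← hm, ← hre.lintegral_comp (by fun_prop)]
    have hrw : ∀ p : ((Fin n → ℂ) × ((ℂ × ℂ) × (Fin n → ℂ))) × ((ℂ × ℂ) × (Fin n → ℂ)),
        ENNReal.ofReal (normSqSum ((k : ℂ)⁻¹ •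
          (scaledOut p.1 + (scaleFactor p.2.1)⁻¹ • p.2.2 - p.1.1))) =
        ENNReal.ofReal ((k ^ 2)⁻¹) * ENNReal.ofReal (normSqSum (quantOut p - p.1.1)) := by
      intro p
      rw [← ENNReal.ofReal_mul (by positivity), normSqSum_smul, norm_inv, hkn, inv_pow]
      rfl
    simp_rw [hrw]
    rw [lintegral_const_mul _ (by fun_prop)]
    refine (mul_le_mul_right hlin _).trans ?_
    rw [← ENNReal.ofReal_mul (by positivity)]
    refine ENNReal.ofReal_le_ofReal (le_of_eq ?_)
    rw [← hk]
    field_simp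
  · refine ENNReal.ofReal_le_ofReal (le_of_eq ?_)
    ring

end Bounds

/-! ### Growth rates relative to the logarithm of SNR -/

section Asymptotics

variable {n : ℕ} {r : ℝ≥0}

lemma toReal_div_log_two (x : ℝ≥0∞) :
    (x / ENNReal.ofReal (Real.log 2)).toReal = x.toReal / Real.log 2 := by
  rw [ENNReal.toReal_div, ENNReal.toReal_ofReal (Real.log_pos one_lt_two).le]

lemma div_log_two_ne_top {x : ℝ≥0∞} (hx : x ≠ ∞) : x / ENNReal.ofReal (Real.log 2) ≠ ∞ :=
  ENNReal.div_ne_top hx (ENNReal.ofReal_pos.mpr (Real.log_pos one_lt_two)).ne'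

lemma mutualInfo_canonicalLaw_ne_top :
    mutualInfo (canonicalLaw n r) quantOut (fun p => p.1.1) ≠ ∞ :=
  div_log_two_ne_top (klDiv_quantOut_input_le.trans_lt ENNReal.ofReal_lt_top).ne

lemma condMutualInfo_canonicalLaw_ne_top (hr : 0 < r) :
    condMutualInfo (canonicalLaw n r) quantOut (fun p => scaledOut p.1) (fun p => p.1.1) ≠ ∞ :=
  div_log_two_ne_top ((klDiv_quantOut_scaledOut_le hr).trans_lt ENNReal.ofReal_lt_top).ne

lemma log_two_le_one : Real.log 2 ≤ 1 := by
  linarith [Real.log_le_sub_one_of_pos (show (0 : ℝ) < 2 by norm_num)]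

lemma logFactor_le (hr : 1 ≤ r) : logFactor r ≤ 3 + Real.log ((r : ℝ) ^ 2) := by
  have hr' : (1 : ℝ) ≤ r := hr
  have h : Real.log (1 + r) ≤ Real.log (2 * r) := Real.log_le_log (by positivity) (by linarith)
  rw [Real.log_mul (by norm_num) (by positivity)] at h
  rw [logFactor, Real.log_pow]
  push_cast
  linarith [log_two_le_one]

/-- Shows that the squared scale k² loses only a doubly logarithmic term against 1/r². This term is
the whole remainder in both the lower bound and the conditional bound. -/
lemma two_mul_log_logFactor_div_le (hr : 1 ≤ r) :
    2 * Real.log (logFactor r / r) ≤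
      2 * Real.log (3 + Real.log ((r : ℝ) ^ 2)) - Real.log ((r : ℝ) ^ 2) := by
  have hr' : (1 : ℝ) ≤ r := hr
  have hL := one_le_logFactor (zero_le_one.trans hr')
  have h : Real.log (logFactor r) ≤ Real.log (3 + Real.log ((r : ℝ) ^ 2)) :=
    Real.log_le_log (by positivity) (logFactor_le hr)
  rw [Real.log_div (by positivity) (by positivity)]
  rw [Real.log_pow] at h ⊢
  push_cast at h ⊢
  linarith

lemma toReal_mutualInfo_canonicalLaw_le (hr : 1 ≤ r) :
    (mutualInfo (canonicalLaw n r) quantOut (fun p => p.1.1)).toReal ≤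
      (n * Real.log ((r : ℝ) ^ 2) + 3 * n) / Real.log 2 := by
  have hr' : (1 : ℝ) ≤ r ^ 2 := one_le_pow₀ hr
  rw [mutualInfo, toReal_div_log_two]
  have hl := (Real.log_pos one_lt_two).le
  have hn := Real.log_nonneg hr'
  gcongr
  refine ENNReal.toReal_le_of_le_ofReal (by positivity)
    (klDiv_quantOut_input_le.trans (ENNReal.ofReal_le_ofReal ?_))
  have h : Real.log (1 + (r : ℝ) ^ 2) ≤ Real.log (2 * r ^ 2) :=
    Real.log_le_log (by positivity) (by linarith)
  rw [Real.log_mul (by norm_num) (by positivity)] at h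
  have : (n : ℝ) * Real.log (1 + (r : ℝ) ^ 2) ≤ n * (1 + Real.log ((r : ℝ) ^ 2)) := by
    gcongr
    linarith [log_two_le_one]
  linarith

lemma le_toReal_mutualInfo_canonicalLaw (hr : 1 ≤ r) :
    (n * Real.log ((r : ℝ) ^ 2) - (2 * n * Real.log (3 + Real.log ((r : ℝ) ^ 2)) + 28 * n)) /
        Real.log 2 ≤
      (mutualInfo (canonicalLaw n r) quantOut (fun p => p.1.1)).toReal := by
  rw [mutualInfo, toReal_div_log_two]
  have hl := (Real.log_pos one_lt_two).le
  gcongr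
  refine le_trans ?_ (le_toReal_klDiv_quantOut_input (zero_lt_one.trans_le hr))
  have h := mul_le_mul_of_nonneg_left (two_mul_log_logFactor_div_le hr) (Nat.cast_nonneg (α := ℝ) n)
  have := Nat.cast_nonneg (α := ℝ) n
  linarith

lemma toReal_condMutualInfo_canonicalLaw_le (hr : 1 ≤ r) :
    (condMutualInfo (canonicalLaw n r) quantOut (fun p => scaledOut p.1)
        (fun p => p.1.1)).toReal ≤
      (2 * n * Real.log (3 + Real.log ((r : ℝ) ^ 2)) + 28 * n) / Real.log 2 := by
  have hr' : (1 : ℝ) ≤ r ^ 2 := one_le_pow₀ hr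
  rw [condMutualInfo, toReal_div_log_two]
  have hl := (Real.log_pos one_lt_two).le
  have hn := Real.log_nonneg hr'
  have hn' := Real.log_nonneg (show 1 ≤ 3 + Real.log ((r : ℝ) ^ 2) by linarith)
  gcongr
  refine ENNReal.toReal_le_of_le_ofReal (by positivity)
    ((klDiv_quantOut_scaledOut_le (zero_lt_one.trans_le hr)).trans
      (ENNReal.ofReal_le_ofReal ?_))
  have h1 := mul_le_mul_of_nonneg_left (two_mul_log_logFactor_div_le hr)
    (Nat.cast_nonneg (α := ℝ) n)
  have h : Real.log (6 + 4 * (r : ℝ) ^ 2) ≤ Real.log (10 * r ^ 2) :=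
    Real.log_le_log (by positivity) (by linarith)
  rw [Real.log_mul (by norm_num) (by positivity)] at h
  -- log 10 ≤ 9, and 28 = 19 + 9.
  have : (n : ℝ) * Real.log (6 + 4 * (r : ℝ) ^ 2) ≤ n * (9 + Real.log ((r : ℝ) ^ 2)) := by
    gcongr
    linarith [Real.log_le_sub_one_of_pos (show (0 : ℝ) < 10 by norm_num)]
  linarith

lemma tendsto_log_add_mul_log_div_log {γ : ℝ} (hγ : 0 < γ) :
    Tendsto (fun s => Real.log (3 + γ * Real.log s) / Real.log s) atTop (𝓝 0) := by
  -- With y = 3 + γ log s, the quotient is (log y / y) · (y / log s), where the first factor tends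
  -- to 0 and the second to γ.
  have hy : Tendsto (fun s => 3 + γ * Real.log s) atTop atTop :=
    tendsto_atTop_add_const_left _ _ (Real.tendsto_log_atTop.const_mul_atTop hγ)
  have h1 : Tendsto (fun s => Real.log (3 + γ * Real.log s) / (3 + γ * Real.log s)) atTop (𝓝 0) :=
    Real.isLittleO_log_id_atTop.tendsto_div_nhds_zero.comp hy
  have h2 : Tendsto (fun s => 3 / Real.log s + γ) atTop (𝓝 (0 + γ)) :=
    (Real.tendsto_log_atTop.const_div_atTop 3).add_const γ
  have h3 := h1.mul h2
  rw [zero_mul] at h3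
  refine h3.congr' ?_
  filter_upwards [Real.tendsto_log_atTop.eventually_gt_atTop 0] with s hs
  have : 3 + γ * Real.log s ≠ 0 := by positivity
  field_simp

lemma tendsto_remainder {γ : ℝ} (hγ : 0 < γ) (a b : ℝ) :
    Tendsto (fun s => (a * Real.log (3 + γ * Real.log s) + b) / Real.log s) atTop (𝓝 0) := by
  have h := ((tendsto_log_add_mul_log_div_log hγ).const_mul a).add
    (Real.tendsto_log_atTop.const_div_atTop b)
  rw [mul_zero, zero_add] at h
  refine h.congr fun s => ?_
  rw [add_div, mul_div_assoc]

lemma tendsto_mutualInfo_div_logb (n : ℕ) {γ : ℝ} (hγ : 0 < γ) {ρ : ℝ → ℝ≥0}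
    (hρ : ∀ s : ℝ, 0 < s → (ρ s : ℝ) ^ 2 = s ^ γ) :
    Tendsto (fun s => (mutualInfo (canonicalLaw n (ρ s)) quantOut (fun p => p.1.1)).toReal /
      Real.logb 2 s) atTop (𝓝 (n * γ)) := by
  have hlo : Tendsto (fun s => n * γ -
      (2 * n * Real.log (3 + γ * Real.log s) + 28 * n) / Real.log s) atTop (𝓝 (n * γ - 0)) :=
    tendsto_const_nhds.sub (tendsto_remainder hγ _ _)
  have hhi : Tendsto (fun s => n * γ + 3 * n / Real.log s) atTop (𝓝 (n * γ + 0)) :=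
    tendsto_const_nhds.add (Real.tendsto_log_atTop.const_div_atTop _)
  rw [sub_zero] at hlo
  rw [add_zero] at hhi
  have hl2 := Real.log_pos one_lt_two
  refine tendsto_of_tendsto_of_tendsto_of_le_of_le' hlo hhi ?_ ?_
  all_goals
    filter_upwards [eventually_gt_atTop 1] with s hs
    have hs0 : 0 < s := zero_lt_one.trans hs
    have hls := Real.log_pos hs
    have hr2 : Real.log ((ρ s : ℝ) ^ 2) = γ * Real.log s := by rw [hρ s hs0, Real.log_rpow hs0]
    have hr : 1 ≤ ρ s := by
      have : (1 : ℝ) ≤ (ρ s : ℝ) ^ 2 := hρ s hs0 ▸ Real.one_le_rpow hs.le hγ.le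
      exact_mod_cast (one_le_sq_iff₀ (ρ s).2).mp this
    have hlo := le_toReal_mutualInfo_canonicalLaw (n := n) hr
    have hhi := toReal_mutualInfo_canonicalLaw_le (n := n) hr
    rw [hr2] at hlo hhi
    rw [Real.logb]
  · rw [le_div_iff₀ (by positivity)]
    refine le_trans (le_of_eq ?_) hlo
    field_simp
  · rw [div_le_iff₀ (by positivity)]
    refine hhi.trans (le_of_eq ?_)
    field_simp

lemma tendsto_condMutualInfo_div_logb (n : ℕ) {γ : ℝ} (hγ : 0 < γ) {ρ : ℝ → ℝ≥0}
    (hρ : ∀ s : ℝ, 0 < s → (ρ s : ℝ) ^ 2 = s ^ γ) :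
    Tendsto (fun s => (condMutualInfo (canonicalLaw n (ρ s)) quantOut (fun p => scaledOut p.1)
      (fun p => p.1.1)).toReal / Real.logb 2 s) atTop (𝓝 0) := by
  have hl2 := Real.log_pos one_lt_two
  refine tendsto_of_tendsto_of_tendsto_of_le_of_le' tendsto_const_nhds
    (tendsto_remainder hγ (2 * n) (28 * n)) ?_ ?_
  all_goals
    filter_upwards [eventually_gt_atTop 1] with s hs
    have hs0 : 0 < s := zero_lt_one.trans hs
    have hls := Real.log_pos hs
    rw [Real.logb]
  · exact div_nonneg ENNReal.toReal_nonneg (by positivity)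
  · have hr2 : Real.log ((ρ s : ℝ) ^ 2) = γ * Real.log s := by rw [hρ s hs0, Real.log_rpow hs0]
    have hr : 1 ≤ ρ s := by
      have : (1 : ℝ) ≤ (ρ s : ℝ) ^ 2 := hρ s hs0 ▸ Real.one_le_rpow hs.le hγ.le
      exact_mod_cast (one_le_sq_iff₀ (ρ s).2).mp this
    have hhi := toReal_condMutualInfo_canonicalLaw_le (n := n) hr
    rw [hr2] at hhi
    rw [div_le_iff₀ (by positivity)]
    refine hhi.trans (le_of_eq ?_)
    field_simp

end Asymptotics

end TrainScale

end

theorem mainTheorem9 (T : ℕ) (hT : 1 ≤ T) (γ : ℝ) (hγ : 0 < γ)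
    (ρ : ℝ → ℝ≥0) (hρ : ∀ s : ℝ, 0 < s → (ρ s : ℝ) ^ 2 = s ^ γ)
    {Ω : ℝ → Type*} [∀ s, MeasurableSpace (Ω s)]
    (P : ∀ s, Measure (Ω s)) [∀ s, IsProbabilityMeasure (P s)]
    (g w' : ∀ s, Ω s → ℂ) (X W Q : ∀ s, Ω s → Fin (T - 1) → ℂ)
    (hmodel : ∀ s : ℝ, 0 < s →
      TrainScale.IsModel (P s) (ρ s) (g s) (w' s) (X s) (W s) (Q s))
    (Y' Yhat : ∀ s, Ω s → Fin (T - 1) → ℂ)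
    (hY' : ∀ s, Y' s = TrainScale.scaled (g s) (w' s) (X s) (W s))
    (hYhat : ∀ s, Yhat s = TrainScale.quantized (g s) (w' s) (X s) (W s) (Q s)) :
    (∀ s : ℝ, 0 < s →
      TrainScale.mutualInfo (P s) (Yhat s) (X s) ≠ ∞ ∧
      TrainScale.condMutualInfo (P s) (Yhat s) (Y' s) (X s) ≠ ∞) ∧
    TrainScale.OrderGE
      (fun s => (TrainScale.mutualInfo (P s) (Yhat s) (X s)).toReal)
      (fun s => ((T : ℝ) - 1) * Real.logb 2 ((ρ s : ℝ) ^ 2)) ∧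
    TrainScale.OrderEq
      (fun s => (TrainScale.condMutualInfo (P s) (Yhat s) (Y' s) (X s)).toReal)
      (fun _ => 0) ∧
    TrainScale.OrderGE
      (fun s => (TrainScale.mutualInfo (P s) (Yhat s) (X s)).toReal -
        (TrainScale.condMutualInfo (P s) (Yhat s) (Y' s) (X s)).toReal)
      (fun s => ((T : ℝ) - 1) * Real.logb 2 ((ρ s : ℝ) ^ 2)) := by
  have hMI : ∀ s : ℝ, 0 < s → TrainScale.mutualInfo (P s) (Yhat s) (X s) =
      TrainScale.mutualInfo (TrainScale.canonicalLaw (T - 1) (ρ s)) TrainScale.quantOut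
        (fun p => p.1.1) := fun s hs => by
    rw [hYhat s, (hmodel s hs).mutualInfo_eq]
  have hCMI : ∀ s : ℝ, 0 < s → TrainScale.condMutualInfo (P s) (Yhat s) (Y' s) (X s) =
      TrainScale.condMutualInfo (TrainScale.canonicalLaw (T - 1) (ρ s)) TrainScale.quantOut
        (fun p => TrainScale.scaledOut p.1) (fun p => p.1.1) := fun s hs => by
    rw [hYhat s, hY' s, (hmodel s hs).condMutualInfo_eq]
  have hρpos : ∀ s : ℝ, 0 < s → 0 < ρ s := fun s hs => by
    have h : (0 : ℝ) < (ρ s : ℝ) ^ 2 := hρ s hs ▸ Real.rpow_pos_of_pos hs γ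
    exact pos_iff_ne_zero.mpr fun h0 => by simp [h0] at h
  have hT1 : ((T - 1 : ℕ) : ℝ) = (T : ℝ) - 1 := by
    rw [Nat.cast_sub hT, Nat.cast_one]
  -- The limit equals that of the comparison function, so both order inequalities hold with equality
  -- of limits.
  have hI : Tendsto (fun s => (TrainScale.mutualInfo (P s) (Yhat s) (X s)).toReal /
      Real.logb 2 s) atTop (𝓝 (((T : ℝ) - 1) * γ)) := by
    rw [← hT1]
    refine (TrainScale.tendsto_mutualInfo_div_logb (T - 1) hγ hρ).congr' ?_
    filter_upwards [eventually_gt_atTop 0] with s hs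
    rw [hMI s hs]
  have hC : Tendsto (fun s => (TrainScale.condMutualInfo (P s) (Yhat s) (Y' s) (X s)).toReal /
      Real.logb 2 s) atTop (𝓝 0) := by
    refine (TrainScale.tendsto_condMutualInfo_div_logb (T - 1) hγ hρ).congr' ?_
    filter_upwards [eventually_gt_atTop 0] with s hs
    rw [hCMI s hs]
  have hR : Tendsto (fun s => ((T : ℝ) - 1) * Real.logb 2 ((ρ s : ℝ) ^ 2) / Real.logb 2 s) atTop
      (𝓝 (((T : ℝ) - 1) * γ)) := by
    refine tendsto_const_nhds.congr' ?_
    filter_upwards [eventually_gt_atTop 1] with s hs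
    have hl : Real.logb 2 s ≠ 0 := (Real.logb_pos one_lt_two hs).ne'
    rw [hρ s (zero_lt_one.trans hs), Real.logb_rpow_eq_mul_logb_of_pos (zero_lt_one.trans hs)]
    field_simp
  refine ⟨fun s hs => ⟨?_, ?_⟩, ⟨_, _, hI, hR, le_rfl⟩, ⟨0, hC, by simp⟩,
    ⟨_, _, ?_, hR, le_rfl⟩⟩
  · rw [hMI s hs]
    exact TrainScale.mutualInfo_canonicalLaw_ne_top
  · rw [hCMI s hs]
    exact TrainScale.condMutualInfo_canonicalLaw_ne_top (hρpos s hs)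
  · simpa only [sub_div, sub_zero] using hI.sub hC
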